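/- Fix $d\ge 1$ and $T>0$. Write points of $\mathbb R^{2d}$ as $z=(x,v)$ with $x,v\in\mathbb R^d$ and put $|(x,v)|_{\mathtt k}=|x|^{1/3}+|v|$. For $s>0$ let $\mathcal H^s_{\mathtt k}$ be the space of $f\in L^2(\mathbb R^{2d};\mathbb C)$ with $$\|f\|_s^2=\int_{\mathbb R^{2d}}(1+|\xi|^{2/3}+|\eta|^2)^s\,|\hat f(\xi,\eta)|^2\,d\xi\,d\eta<\infty,\qquad \hat f(\xi,\eta)=\int e^{-i(\xi\cdot x+\eta\cdot v)}f(x,v)\,dx\,dv,$$ $(\mathcal H^s_{\mathtt k})^*$ its dual with the dual norm, and $\langle\cdot,\cdot\rangle_{-s,s}$ the duality pairing. For a non-integer $\alpha>0$ and a normed space $V$, let $\mathcal C^\alpha_{\mathtt k}(\mathbb R^{2d};V)$ be the space of strongly measurable $F:\mathbb R^{2d}\to V$ with $$\|F\|_{\mathcal C^\alpha_{\mathtt k}}=\|F\|_{L^\infty}+\sup_{h\in\mathbb R^{2d},\,h\ne0}\frac{\|\delta_h^{([\alpha]+1)}F\|_{L^\infty}}{|h|_{\mathtt k}^\alpha}<\infty,\qquad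 \delta_hF(z)=F(z+h)-F(z),$$ where $\delta_h^{(m)}$ is the $m$-fold iterate of $\delta_h$ and $[\alpha]$ the integer part of $\alpha$. For $t\ge0$ let $$P_tf(x,v)=\mathbb E\Big[f\Big(x+tv+\sqrt2\int_0^tB_r\,dr,\;v+\sqrt2B_t\Big)\Big],$$ with $B$ a standard $d$-dimensional Brownian motion. Let $s>0$, let $\alpha>s$ be non-integer, and let $\Gamma:\mathbb R^{2d}\times\mathbb R^{2d}\to\mathbb R^d$ be such that $\|\Gamma\|_{s,\alpha}<\infty$, that is, for each component $\Gamma_i$ one has $\Gamma_i(z,\cdot)\in\mathcal H^s_{\mathtt k}$ for every $z$, and the map $z\mapsto\Gamma_i(z,\cdot)$ belongs to $\mathcal C^\alpha_{\mathtt k}(\mathbb R^{2d};\mathcal H^s_{\mathtt k})$. For $\mu\in(\mathcal H^s_{\mathtt k})^*$ put $(\Gamma*\mu)(z)=\langle\mu,\Gamma(z,\cdot)\rangle_{-s,s}$ (componentwise). Let $\nu_0\in(\mathcal H^s_{\mathtt k})^*$. An $s$-weak-mild solution with initial datum $\nu_0$ of the kinetic nonlinear Fokker–Planck equation $$\partial_t\nu_t+v\cdot\nabla_x\nu_t=\Delta_v\nu_t-\operatorname{div}_v[\nu_t(\Gamma*\nu_t)],\qquad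 0\le t\le T,$$ is a $\nu\in L^\infty([0,T],(\mathcal H^s_{\mathtt k})^*)$, defined at every $t\in[0,T]$, such that for every $f\in\mathcal H^s_{\mathtt k}$ and every $t\in[0,T]$ $$\langle\nu_t,f\rangle_{-s,s}=\langle\nu_0,P_tf\rangle_{-s,s}+\int_0^t\big\langle\nu_r,\,(\nabla_vP_{t-r}f)\cdot(\Gamma*\nu_r)\big\rangle_{-s,s}\,dr .$$ Then there is at most one $s$-weak-mild solution with initial datum $\nu_0$: if $\nu$ and $\rho$ are two of them, then $\nu_t=\rho_t$ for every $t\in[0,T]$. -/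

import Mathlib

open MeasureTheory Set
open scoped ENNReal FourierTransform

noncomputable section

namespace KineticFP

/-! ### Phase space -/

/-- The phase space `ℝ^{2d} = ℝ^d × ℝ^d` of pairs `(x, v)`, with its Euclidean structure (so that
`volume` is Lebesgue measure and `𝓕` is the usual Fourier transform on `ℝ^{2d}`). -/
abbrev Phase (d : ℕ) : Type :=
  WithLp 2 (EuclideanSpace ℝ (Fin d) × EuclideanSpace ℝ (Fin d))

/-- The point `(x, v)` of phase space. -/
abbrev mkPhase {d : ℕ} (x v : EuclideanSpace ℝ (Fin d)) : Phase d := WithLp.toLp 2 (x, v)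

/-- The kinetic length `|(x, v)|_k = |x|^{1/3} + |v|`. -/
def kinLength {d : ℕ} (h : Phase d) : ℝ := ‖h.fst‖ ^ (1 / 3 : ℝ) + ‖h.snd‖

/-! ### The kinetic Sobolev space `H^s_k(ℝ^{2d})`, `s ≥ 0` -/

/-- The weight `1 + |ξ|^{2/3} + |η|^2`. -/
def kinWeight {d : ℕ} (ζ : Phase d) : ℝ := 1 + ‖ζ.fst‖ ^ (2 / 3 : ℝ) + ‖ζ.snd‖ ^ 2

/-- The square root of the weight `(1 + |ξ|^{2/3} + |η|^2)^s`, written in the variable `ζ` of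
Mathlib's Fourier transform `𝓕 f (ζ) = ∫ exp (-2πi ζ·z) f(z) dz`.  The Fourier transform
`f^(ξ, η) = ∫ exp (-i (ξ·x + η·v)) f` is `𝓕 f` at `(ξ, η) / 2π`; hence the argument `2πζ` and the
Jacobian factor `(2π)^{2d}` (here under a square root), which give
`∫ |sobWeight s ζ • 𝓕 f ζ|^2 dζ = ∫ (1 + |ξ|^{2/3} + |η|^2)^s |f^(ξ, η)|^2 dξ dη`. -/
def sobWeight {d : ℕ} (s : ℝ) (ζ : Phase d) : ℝ :=
  (2 * Real.pi) ^ d * kinWeight ((2 * Real.pi) • ζ) ^ (s / 2)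

theorem sobWeight_pos {d : ℕ} (s : ℝ) (ζ : Phase d) : 0 < sobWeight s ζ := by
  have := Real.pi_pos
  unfold sobWeight kinWeight
  positivity

/-- The complex `L²` space on phase space. -/
abbrev L2 (d : ℕ) : Type := Lp ℂ 2 (volume : Measure (Phase d))

/-- The weighted Fourier transform `(1 + |ξ|^{2/3} + |η|^2)^{s/2} f^`, normalized as above. -/
def weightedFourier {d : ℕ} (s : ℝ) (f : L2 d) (ζ : Phase d) : ℂ :=
  sobWeight s ζ • (𝓕 f : L2 d) ζ

theorem weightedFourier_add {d : ℕ} (s : ℝ) (f g : L2 d) :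
    weightedFourier s (f + g) =ᵐ[volume] weightedFourier s f + weightedFourier s g := by
  have h : (𝓕 (f + g) : L2 d) = 𝓕 f + 𝓕 g := FourierTransform.fourier_add f g
  filter_upwards [Lp.coeFn_add (𝓕 f : L2 d) (𝓕 g)] with ζ hζ
  simp only [weightedFourier, h, hζ, Pi.add_apply, smul_add]

theorem weightedFourier_smul {d : ℕ} (s : ℝ) (c : ℂ) (f : L2 d) :
    weightedFourier s (c • f) =ᵐ[volume] c • weightedFourier s f := by
  have h : (𝓕 (c • f) : L2 d) = c • 𝓕 f := FourierTransform.fourier_smul c f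
  filter_upwards [Lp.coeFn_smul c (𝓕 f : L2 d)] with ζ hζ
  simp only [weightedFourier, h, hζ, Pi.smul_apply]
  rw [smul_comm]

/-- The kinetic Sobolev space as a subspace of `L²`: all `f` with
`∫ (1 + |ξ|^{2/3} + |η|^2)^s |f^(ξ, η)|^2 < ∞`.  As the weight is at least `1`, for `s ≥ 0` every
tempered distribution with this property is an `L²` function. -/
def sobSubmodule (d : ℕ) (s : ℝ) : Submodule ℂ (L2 d) where
  carrier := {f | MemLp (weightedFourier s f) 2 volume}
  add_mem' {f g} hf hg := (memLp_congr_ae (weightedFourier_add s f g)).mpr (MemLp.add hf hg)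
  zero_mem' := by
    have h := weightedFourier_smul s (0 : ℂ) (0 : L2 d)
    simp only [zero_smul] at h
    exact (memLp_congr_ae h).mpr MemLp.zero
  smul_mem' c f hf :=
    (memLp_congr_ae (weightedFourier_smul s c f)).mpr (MemLp.const_smul hf c)

/-- `f ↦ (1 + |ξ|^{2/3} + |η|^2)^{s/2} f^` as a linear map on the subspace. -/
def weightedFourierₗ (d : ℕ) (s : ℝ) : ↥(sobSubmodule d s) →ₗ[ℂ] L2 d where
  toFun f := MemLp.toLp (weightedFourier s f.1) f.2
  map_add' f g := ((MemLp.toLp_eq_toLp_iff (f + g).2 (MemLp.add f.2 g.2)).mpr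
    (weightedFourier_add s f.1 g.1)).trans (MemLp.toLp_add f.2 g.2)
  map_smul' c f := ((MemLp.toLp_eq_toLp_iff (c • f).2 (MemLp.const_smul f.2 c)).mpr
    (weightedFourier_smul s c f.1)).trans (MemLp.toLp_const_smul c f.2)

/-- The kinetic Sobolev space `H^s_k(ℝ^{2d})` as a type of its own; it carries the norm `‖·‖_s`
below and not the `L²` norm. -/
def HSob (d : ℕ) (s : ℝ) : Type := ↥(sobSubmodule d s)

instance (d : ℕ) (s : ℝ) : AddCommGroup (HSob d s) :=
  inferInstanceAs (AddCommGroup ↥(sobSubmodule d s))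

instance (d : ℕ) (s : ℝ) : Module ℂ (HSob d s) :=
  inferInstanceAs (Module ℂ ↥(sobSubmodule d s))

/-- The underlying `L²` function. -/
def HSob.toL2 {d : ℕ} {s : ℝ} (f : HSob d s) : L2 d := f.1

/-- The element of `H^s_k` given by an `L²` function in the subspace. -/
def HSob.mk {d : ℕ} {s : ℝ} (f : L2 d) (hf : f ∈ sobSubmodule d s) : HSob d s := ⟨f, hf⟩

/-- `f ↦ (1 + |ξ|^{2/3} + |η|^2)^{s/2} f^`, from `H^s_k` to `L²`. -/
def HSob.toWeighted (d : ℕ) (s : ℝ) : HSob d s →ₗ[ℂ] L2 d := weightedFourierₗ d s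

theorem HSob.toWeighted_injective (d : ℕ) (s : ℝ) :
    Function.Injective (HSob.toWeighted d s) := by
  refine (injective_iff_map_eq_zero _).mpr fun f hf => ?_
  have h1 : weightedFourier s f.toL2 =ᵐ[volume] (0 : Phase d → ℂ) :=
    (MemLp.coeFn_toLp f.2).symm.trans ((congrArg (fun g : L2 d => (g : Phase d → ℂ)) hf) ▸
      Lp.coeFn_zero ℂ 2 volume)
  have h2 : (𝓕 f.toL2 : L2 d) = 0 := by
    refine (Lp.eq_zero_iff_ae_eq_zero).mpr ?_
    filter_upwards [h1] with ζ hζ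
    exact (smul_eq_zero.mp hζ).resolve_left (sobWeight_pos s ζ).ne'
  have h3 : f.toL2 = 0 := by
    rw [← norm_eq_zero, ← Lp.norm_fourier_eq, h2, norm_zero]
  exact Subtype.ext h3

/-- The norm `‖f‖_s = (∫ (1 + |ξ|^{2/3} + |η|^2)^s |f^(ξ, η)|^2 dξ dη)^{1/2}`. -/
instance (d : ℕ) (s : ℝ) : NormedAddCommGroup (HSob d s) :=
  NormedAddCommGroup.induced (HSob d s) (L2 d) (HSob.toWeighted d s)
    (HSob.toWeighted_injective d s)

instance (d : ℕ) (s : ℝ) : NormedSpace ℂ (HSob d s) :=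
  NormedSpace.induced ℂ (HSob d s) (L2 d) (HSob.toWeighted d s)

/-- A function `g` on phase space belongs to `H^s_k` (as an almost everywhere class). -/
def MemHSob {d : ℕ} (s : ℝ) (g : Phase d → ℂ) : Prop :=
  ∃ h : MemLp g 2 volume, h.toLp g ∈ sobSubmodule d s

open Classical in
/-- The element of `H^s_k` given by a function `g`; by convention it is `0` if `g` is not in
`H^s_k`. -/
def HSob.ofFun {d : ℕ} (s : ℝ) (g : Phase d → ℂ) : HSob d s :=
  if h : MemHSob s g then HSob.mk (h.choose.toLp g) h.choose_spec else 0

/-- The dual space `(H^s_k)^*` with its dual norm. -/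
abbrev HDual (d : ℕ) (s : ℝ) : Type := StrongDual ℂ (HSob d s)

/-- The duality pairing `⟨μ, g⟩_{-s,s}` with a function `g` in `H^s_k`. -/
def pairing {d : ℕ} {s : ℝ} (μ : HDual d s) (g : Phase d → ℂ) : ℂ := μ (HSob.ofFun s g)

/-! ### The kinetic Hölder space `C^α_k(ℝ^{2d}; V)` -/

/-- The difference operator `δ_h F(z) = F(z + h) - F(z)`. -/
def diffOp {d : ℕ} {V : Type*} [AddCommGroup V] (h : Phase d) (F : Phase d → V) : Phase d → V :=
  fun z => F (z + h) - F z

/-- The kinetic Hölder norm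
`‖F‖_{L^∞} + sup_{h ≠ 0} |h|_k^{-α} ‖δ_h^{([α] + 1)} F‖_{L^∞}` of a function with values in a
normed space. -/
def kinHolderNorm {d : ℕ} {V : Type*} [NormedAddCommGroup V] (α : ℝ) (F : Phase d → V) : ℝ≥0∞ :=
  eLpNorm F ⊤ volume +
    ⨆ (h : Phase d) (_ : h ≠ 0),
      eLpNorm ((diffOp h)^[⌊α⌋₊ + 1] F) ⊤ volume / ENNReal.ofReal (kinLength h ^ α)

/-- Membership in the kinetic Hölder space `C^α_k(ℝ^{2d}; V)`. -/
def MemKinHolder {d : ℕ} {V : Type*} [NormedAddCommGroup V] (α : ℝ) (F : Phase d → V) : Prop :=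
  AEStronglyMeasurable F volume ∧ kinHolderNorm α F < ⊤

/-- `‖Γ‖_{s,α} < ∞`: for every `z` the components of `Γ(z, ·)` belong to `H^s_k`, and
`z ↦ Γ(z, ·)` is, component by component, a function of class `C^α_k` with values in `H^s_k`. -/
def FiniteInteractionNorm {d : ℕ} (s α : ℝ)
    (Γ : Phase d → Phase d → EuclideanSpace ℝ (Fin d)) : Prop :=
  ∀ i : Fin d, (∀ z, MemHSob s fun w => (Γ z w i : ℂ)) ∧
    MemKinHolder α fun z => HSob.ofFun s fun w => (Γ z w i : ℂ)

/-! ### The kinetic semigroup -/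

/-- The density of `(√2 ∫₀ᵗ B_r dr, √2 B_t)`, for `t > 0` and `B` a standard Brownian motion on
`ℝ^d`: the centred Gaussian density whose covariance, in each coordinate, is
`[[2t³/3, t²], [t², 2t]]`, of determinant `t⁴/3`. -/
def kinKernel {d : ℕ} (t : ℝ) (z : Phase d) : ℝ :=
  (4 * Real.pi ^ 2 * t ^ 4 / 3) ^ (-(d : ℝ) / 2) *
    Real.exp (-(3 * ‖z.fst‖ ^ 2 + ‖(3 : ℝ) • z.fst - (2 * t) • z.snd‖ ^ 2) / (4 * t ^ 3))

open Classical in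
/-- The kinetic semigroup `P_t f(x, v) = E[f(x + tv + √2 ∫₀ᵗ B_r dr, v + √2 B_t)]`, `t ≥ 0`, with
`P_0 f = f`; its generator is `Δ_v + v·∇_x`. -/
def kinSemigroup {d : ℕ} (t : ℝ) (f : Phase d → ℂ) : Phase d → ℂ :=
  if t = 0 then f else fun z =>
    ∫ y : Phase d, (kinKernel t y : ℂ) * f (mkPhase (z.fst + t • z.snd + y.fst) (z.snd + y.snd))

/-- The velocity derivative `∂_{v_i} g`. -/
def velDeriv {d : ℕ} (i : Fin d) (g : Phase d → ℂ) : Phase d → ℂ :=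
  fun z => lineDeriv ℝ g z (mkPhase 0 (EuclideanSpace.single i 1))

/-! ### Weak-mild solutions -/

/-- The `i`-th component of the generalised convolution
`(Γ * μ)(z) = ⟨μ, Γ(z, ·)⟩_{-s,s}`. -/
def genConv {d : ℕ} {s : ℝ} (Γ : Phase d → Phase d → EuclideanSpace ℝ (Fin d)) (μ : HDual d s)
    (i : Fin d) : Phase d → ℂ :=
  fun z => pairing μ fun w => (Γ z w i : ℂ)

/-- `ν` is an `s`-weak-mild solution on `[0, T]`, with initial datum `ν₀`, of the kinetic nonlinear
Fokker–Planck equation `∂_t ν + v·∇_x ν = Δ_v ν - div_v [ν (Γ * ν)]`: it is of class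
`L^∞([0, T], (H^s_k)^*)` and for all `f ∈ H^s_k` and all `t ∈ [0, T]`
`⟨ν_t, f⟩ = ⟨ν₀, P_t f⟩ + ∫₀ᵗ ⟨ν_r, ∇_v P_{t-r} f · (Γ * ν_r)⟩ dr`. -/
structure IsWeakMildSolution {d : ℕ} {s : ℝ} (T : ℝ)
    (Γ : Phase d → Phase d → EuclideanSpace ℝ (Fin d)) (ν₀ : HDual d s) (ν : ℝ → HDual d s) :
    Prop where
  memLp : MemLp ν ⊤ (volume.restrict (Icc 0 T))
  mild : ∀ f : HSob d s, ∀ t ∈ Icc 0 T,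
    ν t f = pairing ν₀ (kinSemigroup t f.toL2) +
      ∫ r in (0 : ℝ)..t, pairing (ν r) fun z =>
        ∑ i : Fin d, velDeriv i (kinSemigroup (t - r) f.toL2) z * genConv Γ (ν r) i z

end KineticFP

end

/-! The nonlinearity is quadratic in `ν`, so the difference of two bounded solutions obeys a linear
Volterra inequality as soon as the operator `f ↦ ∇_v P_τ f · (Γ * μ)` is bounded on `H^s_k` with
norm at most a constant times `τ^(-1/2) ‖μ‖`. The singularity `τ^(-1/2)` is integrable, so against a
weight `exp (l t)` with `l` large the inequality contracts by a factor `1/2`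
(`exists_abel_kernel_le`, `exists_contraction`). Iterating the contraction from the essential bounds
of the two solutions forces the difference to vanish at every time.

The operator bound has two sources. The first is smoothing (`exists_kinWeight_mul_velSymbol_le`). In
Fourier variables `∂_{v_i} P_t` is multiplication by a Gaussian symbol followed by the
volume-preserving shear `(ξ, η) ↦ (ξ, η + tξ)`. With `U = t³|ξ|² + t|η|²`, the derivative costs `(U
/ t)^(1/2)`, the shear enlarges the Sobolev weight by at most `3 (1 + U)`, and the decay of the
Gaussian in `U` absorbs every power of `1 + U`. Only `t^(-1/2)` is left.

The second is multiplication (`exists_sobEnergy_mul_le`): a function of kinetic Hölder regularity `α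
> s` multiplies `H^s_k`. The Sobolev energy is compared with a dyadic sum of squared iterated
differences along coordinate directions (`exists_sobEnergy_le`, `exists_sum_diffOp_le_sobEnergy`),
and a Leibniz estimate sends enough differences to one factor or to the other. The multiplier `Γ *
μ` is a bounded functional applied to `z ↦ Γ(z, ·)`, so it inherits the Hölder bounds, with constant
proportional to `‖μ‖` (`exists_mulGenConv`).

Subtracting the two mild identities also requires the time integrands to be integrable; their
measurability comes from the continuity of `t ↦ ∂_{v_i} P_t f` in `H^s_k` for `t > 0`
(`continuousOn_velGrad`). -/

noncomputable section

namespace KineticFP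

/-! ### Fourier characters -/

section Phase

variable {E : Type*} [NormedAddCommGroup E] [InnerProductSpace ℝ E]

/-- The character `ζ ↦ exp (2πi a·ζ)`. -/
def phase (a ζ : E) : ℂ := Complex.exp ((2 * Real.pi * inner ℝ a ζ : ℝ) * Complex.I)

theorem norm_phase (a ζ : E) : ‖phase a ζ‖ = 1 := Complex.norm_exp_ofReal_mul_I _

theorem contDiff_phase (a : E) : ContDiff ℝ (⊤ : ℕ∞) (phase a) := by
  have h : ContDiff ℝ (⊤ : ℕ∞) fun ζ : E => 2 * Real.pi * inner ℝ a ζ :=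
    contDiff_const.mul (contDiff_const.inner ℝ contDiff_id)
  exact ((Complex.ofRealCLM.contDiff.comp h).mul contDiff_const).cexp

end Phase

/-! ### The `L²` Fourier transform: Fourier integrals and translations -/

section FourierL2

variable {E : Type*} [NormedAddCommGroup E] [InnerProductSpace ℝ E] [FiniteDimensional ℝ E]
  [MeasurableSpace E] [BorelSpace E]

/-- The multiplication formula for the `L²` Fourier transform against a Schwartz function. -/
theorem integral_mul_fourier_L2 (f : Lp ℂ 2 (volume : Measure E)) (ψ : SchwartzMap E ℂ) :
    ∫ x, ψ x * (𝓕 f : Lp ℂ 2 (volume : Measure E)) x = ∫ x, (𝓕 (ψ : E → ℂ)) x * f x := by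
  have h := congrArg (fun T => T ψ) (Lp.fourier_toTemperedDistribution_eq f)
  simp only [TemperedDistribution.fourier_apply, Lp.toTemperedDistribution_apply,
    smul_eq_mul] at h
  rw [← h, SchwartzMap.fourier_coe]

theorem integral_mul_fourierInv_L2 (f : Lp ℂ 2 (volume : Measure E)) (ψ : SchwartzMap E ℂ) :
    ∫ x, ψ x * (𝓕⁻ f : Lp ℂ 2 (volume : Measure E)) x = ∫ x, (𝓕⁻ (ψ : E → ℂ)) x * f x := by
  have h := congrArg (fun T => T ψ) (Lp.fourierInv_toTemperedDistribution_eq f)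
  simp only [TemperedDistribution.fourierInv_apply, Lp.toTemperedDistribution_apply,
    smul_eq_mul] at h
  rw [← h, SchwartzMap.fourierInv_coe]

/-- Real smooth functions of compact support already separate locally integrable functions, and each
of them is a complex Schwartz function. -/
theorem ae_eq_of_integral_schwartz {u v : E → ℂ} (hu : LocallyIntegrable u)
    (hv : LocallyIntegrable v)
    (h : ∀ ψ : SchwartzMap E ℂ, HasCompactSupport ψ → ∫ x, ψ x * u x = ∫ x, ψ x * v x) :
    u =ᵐ[volume] v := by
  refine ae_eq_of_integral_contDiff_smul_eq hu hv fun g g_smooth g_cpt => ?_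
  have hg₁ : HasCompactSupport (Complex.ofRealCLM ∘ g) := g_cpt.comp_left rfl
  have hg₂ : ContDiff ℝ (⊤ : ℕ∞) (Complex.ofRealCLM ∘ g) :=
    Complex.ofRealCLM.contDiff.comp g_smooth
  simpa using h (hg₁.toSchwartzMap hg₂) hg₁

/-- On `L¹ ∩ L²` the `L²` Fourier transform is the Fourier integral. -/
theorem fourier_toLp_ae_eq {h : E → ℂ} (h1 : Integrable h) (h2 : MemLp h 2 volume) :
    (𝓕 (h2.toLp h) : Lp ℂ 2 (volume : Measure E)) =ᵐ[volume] 𝓕 h := by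
  have hc : Continuous (𝓕 h) :=
    VectorFourier.fourierIntegral_continuous Real.continuous_fourierChar
      (by exact continuous_inner) h1
  refine ae_eq_of_integral_schwartz ((Lp.memLp _).locallyIntegrable one_le_two)
    hc.locallyIntegrable fun ψ _ => ?_
  rw [integral_mul_fourier_L2]
  have := VectorFourier.integral_fourierIntegral_smul_eq_flip (L := innerₗ E)
    Real.continuous_fourierChar (by exact continuous_inner) (ψ.integrable (μ := volume)) h1
  simp only [smul_eq_mul, flip_innerₗ] at this
  refine Eq.trans ?_ this
  refine integral_congr_ae ?_
  filter_upwards [h2.coeFn_toLp] with x hx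
  rw [hx]; rfl

theorem fourierInv_toLp_ae_eq {h : E → ℂ} (h1 : Integrable h) (h2 : MemLp h 2 volume) :
    (𝓕⁻ (h2.toLp h) : Lp ℂ 2 (volume : Measure E)) =ᵐ[volume] 𝓕⁻ h := by
  have hin : Continuous fun p : E × E => (-innerₗ E) p.1 p.2 := by
    have h : Continuous fun p : E × E => -(inner ℝ p.1 p.2 : ℝ) :=
      (continuous_fst.inner continuous_snd).neg
    exact h
  have hc : Continuous (𝓕⁻ h) :=
    VectorFourier.fourierIntegral_continuous Real.continuous_fourierChar hin h1
  refine ae_eq_of_integral_schwartz ((Lp.memLp _).locallyIntegrable one_le_two)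
    hc.locallyIntegrable fun ψ _ => ?_
  rw [integral_mul_fourierInv_L2]
  have := VectorFourier.integral_fourierIntegral_smul_eq_flip (L := -innerₗ E)
    Real.continuous_fourierChar hin (ψ.integrable (μ := volume)) h1
  have hfl : (-innerₗ E).flip = -innerₗ E := by
    ext x y; simp [real_inner_comm]
  simp only [smul_eq_mul, hfl] at this
  refine Eq.trans ?_ this
  refine integral_congr_ae ?_
  filter_upwards [h2.coeFn_toLp] with x hx
  rw [hx]; rfl

theorem fourier_phase_mul (a : E) (f : E → ℂ) (x : E) :
    𝓕 (fun ζ => phase a ζ * f ζ) x = 𝓕 f (x - a) := by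
  rw [Real.fourier_eq', Real.fourier_eq']
  refine integral_congr_ae (Filter.Eventually.of_forall fun v => ?_)
  simp only [smul_eq_mul, ← mul_assoc, phase, ← Complex.exp_add]
  congr 2
  rw [inner_sub_right, real_inner_comm a v]
  push_cast; ring

/-- The Fourier transform turns translations into multiplication by characters. -/
theorem fourier_translate (f : Lp ℂ 2 (volume : Measure E)) (a : E) :
    (𝓕 (Lp.compMeasurePreserving (· + a) (measurePreserving_add_right volume a) f) :
      Lp ℂ 2 (volume : Measure E)) =ᵐ[volume]
      fun ζ => phase a ζ * (𝓕 f : Lp ℂ 2 (volume : Measure E)) ζ := by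
  have hphase : Continuous (phase a) := (contDiff_phase a).continuous
  have hm : MemLp (fun ζ => phase a ζ * (𝓕 f : Lp ℂ 2 (volume : Measure E)) ζ) 2 volume := by
    refine (Lp.memLp (𝓕 f : Lp ℂ 2 (volume : Measure E))).of_le_mul (c := 1)
      (hphase.aestronglyMeasurable.mul (Lp.aestronglyMeasurable _)) ?_
    exact Filter.Eventually.of_forall fun ζ => by rw [norm_mul, norm_phase]
  refine ae_eq_of_integral_schwartz ((Lp.memLp _).locallyIntegrable one_le_two)
    (hm.locallyIntegrable one_le_two) fun ψ hψ => ?_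
  -- The character is moved onto the test function. Compact support of `ψ` is what makes the product
  -- Schwartz at once; its Fourier transform is that of `ψ` translated by `a`.
  let χ : SchwartzMap E ℂ := HasCompactSupport.toSchwartzMap (f := fun ζ => phase a ζ * ψ ζ)
    hψ.mul_left ((contDiff_phase a).mul (ψ.smooth ⊤))
  have hχ : ∀ ζ, χ ζ = phase a ζ * ψ ζ := fun ζ => rfl
  rw [integral_mul_fourier_L2]
  have h1 := integral_mul_fourier_L2 f χ
  have h2 : (𝓕 (χ : E → ℂ)) = fun x => 𝓕 (ψ : E → ℂ) (x - a) :=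
    funext fun x => fourier_phase_mul a ψ x
  rw [h2] at h1
  rw [← integral_add_right_eq_self (fun x => 𝓕 (ψ : E → ℂ) (x - a) * f x) a] at h1
  simp only [add_sub_cancel_right] at h1
  calc _ = ∫ x, 𝓕 (ψ : E → ℂ) x * f (x + a) := by
        refine integral_congr_ae ?_
        filter_upwards [Lp.coeFn_compMeasurePreserving f
          (measurePreserving_add_right volume a)] with x hx
        rw [hx]; rfl
    _ = _ := h1.symm
    _ = _ := by
        refine integral_congr_ae (Filter.Eventually.of_forall fun x => ?_)
        simp only [hχ]; ring

end FourierL2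

/-! ### Iterated differences: Leibniz estimate and Plancherel identity -/

section Differences

variable {d : ℕ}

theorem diffOp_congr_ae {V : Type*} [AddCommGroup V] (h : Phase d) {u v : Phase d → V}
    (huv : u =ᵐ[volume] v) : diffOp h u =ᵐ[volume] diffOp h v := by
  have h1 : (fun z => u (z + h)) =ᵐ[volume] fun z => v (z + h) :=
    (measurePreserving_add_right volume h).quasiMeasurePreserving.ae_eq_comp huv
  filter_upwards [huv, h1] with z hz h1z
  simp only [diffOp]
  rw [hz, h1z]

theorem diffOp_iterate_congr_ae {V : Type*} [AddCommGroup V] (h : Phase d) (m : ℕ)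
    {u v : Phase d → V} (huv : u =ᵐ[volume] v) :
    (diffOp h)^[m] u =ᵐ[volume] (diffOp h)^[m] v := by
  induction m generalizing u v with
  | zero => exact huv
  | succ m ih => exact ih (diffOp_congr_ae h huv)

theorem aestronglyMeasurable_translate {V : Type*} [TopologicalSpace V] (h : Phase d)
    {u : Phase d → V} (hu : AEStronglyMeasurable u volume) :
    AEStronglyMeasurable (fun z => u (z + h)) volume :=
  hu.comp_quasiMeasurePreserving (measurePreserving_add_right volume h).quasiMeasurePreserving

theorem aestronglyMeasurable_diffOp {V : Type*} [NormedAddCommGroup V] (h : Phase d)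
    {u : Phase d → V} (hu : AEStronglyMeasurable u volume) :
    AEStronglyMeasurable (diffOp h u) volume :=
  (aestronglyMeasurable_translate h hu).sub hu

theorem aestronglyMeasurable_diffOp_iterate {V : Type*} [NormedAddCommGroup V] (h : Phase d)
    (m : ℕ) {u : Phase d → V} (hu : AEStronglyMeasurable u volume) :
    AEStronglyMeasurable ((diffOp h)^[m] u) volume := by
  induction m generalizing u with
  | zero => exact hu
  | succ m ih => exact ih (aestronglyMeasurable_diffOp h hu)

theorem eLpNorm_translate {V : Type*} [NormedAddCommGroup V] (h : Phase d) (p : ℝ≥0∞)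
    {u : Phase d → V} (hu : AEStronglyMeasurable u volume) :
    eLpNorm (fun z => u (z + h)) p volume = eLpNorm u p volume :=
  eLpNorm_comp_measurePreserving hu (measurePreserving_add_right volume h)

theorem eLpNorm_diffOp_le {V : Type*} [NormedAddCommGroup V] (h : Phase d) {p : ℝ≥0∞}
    (hp : 1 ≤ p) {u : Phase d → V} (hu : AEStronglyMeasurable u volume) :
    eLpNorm (diffOp h u) p volume ≤ 2 * eLpNorm u p volume := by
  refine (eLpNorm_sub_le (aestronglyMeasurable_translate h hu) hu hp).trans ?_
  rw [eLpNorm_translate h p hu, two_mul]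

theorem diffOp_iterate_translate {V : Type*} [AddCommGroup V] (h : Phase d) (m : ℕ)
    (u : Phase d → V) :
    (diffOp h)^[m] (fun z => u (z + h)) = fun z => (diffOp h)^[m] u (z + h) := by
  induction m generalizing u with
  | zero => rfl
  | succ m ih => exact ih (diffOp h u)

theorem diffOp_iterate_add {V : Type*} [AddCommGroup V] (h : Phase d) (m : ℕ)
    (u v : Phase d → V) :
    (diffOp h)^[m] (u + v) = (diffOp h)^[m] u + (diffOp h)^[m] v := by
  induction m generalizing u v with
  | zero => rfl
  | succ m ih =>
    simp only [Function.iterate_succ_apply]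
    rw [← ih]
    congr 1
    funext z
    simp only [diffOp, Pi.add_apply]; abel

theorem diffOp_mul (h : Phase d) (φ g : Phase d → ℂ) :
    diffOp h (fun z => φ z * g z) =
      (fun z => φ (z + h) * diffOp h g z) + fun z => diffOp h φ z * g z := by
  funext z
  simp only [diffOp, Pi.add_apply]; ring

theorem eLpNorm_mul_le_top_two (φ : Phase d → ℂ) {g : Phase d → ℂ}
    (hg : AEStronglyMeasurable g volume) :
    eLpNorm (fun z => φ z * g z) 2 volume ≤ eLpNorm φ ⊤ volume * eLpNorm g 2 volume := by
  exact eLpNorm_smul_le_eLpNorm_top_mul_eLpNorm (p := 2) hg φ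

theorem eLpNorm_diffOp_iterate_le {V : Type*} [NormedAddCommGroup V] (h : Phase d) {p : ℝ≥0∞}
    (hp : 1 ≤ p) (m : ℕ) {u : Phase d → V} (hu : AEStronglyMeasurable u volume) :
    eLpNorm ((diffOp h)^[m] u) p volume ≤ 2 ^ m * eLpNorm u p volume := by
  induction m generalizing u with
  | zero => simp
  | succ m ih =>
    refine (ih (aestronglyMeasurable_diffOp h hu)).trans ?_
    rw [pow_succ, mul_assoc]
    gcongr
    exact eLpNorm_diffOp_le h hp hu

/-- A Leibniz estimate for iterated differences: the differences fall either on the first factor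
at least `a` times or on the second factor at least `b` times. -/
theorem eLpNorm_diffOp_iterate_mul_le (h : Phase d) (a b : ℕ) {φ g : Phase d → ℂ}
    (hφ : AEStronglyMeasurable φ volume) (hg : AEStronglyMeasurable g volume) :
    eLpNorm ((diffOp h)^[a + b] fun z => φ z * g z) 2 volume ≤
      3 ^ (a + b) * (eLpNorm ((diffOp h)^[a] φ) ⊤ volume * eLpNorm g 2 volume +
        eLpNorm φ ⊤ volume * eLpNorm ((diffOp h)^[b] g) 2 volume) := by
  -- The crude bound settles `a = 0` and `b = 0`, where one of the two terms on the right is the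
  -- undifferenced product of norms.
  have base : ∀ {φ g : Phase d → ℂ}, AEStronglyMeasurable φ volume →
      AEStronglyMeasurable g volume → ∀ m : ℕ,
      eLpNorm ((diffOp h)^[m] fun z => φ z * g z) 2 volume ≤
        3 ^ m * (eLpNorm φ ⊤ volume * eLpNorm g 2 volume) := fun hφ hg m => by
    refine (eLpNorm_diffOp_iterate_le h one_le_two m (hφ.mul hg)).trans ?_
    gcongr
    · norm_num
    · exact eLpNorm_mul_le_top_two _ hg
  induction hn : a + b generalizing a b φ g with
  | zero =>
    obtain ⟨rfl, rfl⟩ : a = 0 ∧ b = 0 := by omega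
    simpa using (eLpNorm_mul_le_top_two _ hg).trans le_self_add
  | succ n ih =>
    rcases a with _ | a
    · refine (base hφ hg _).trans ?_
      gcongr
      exact le_self_add
    rcases b with _ | b
    · refine (base hφ hg _).trans ?_
      gcongr
      exact le_add_self
    -- One difference is spent on the product. The term with `δ_h g` then needs `b` further
    -- differences on the second factor, the term with `δ_h φ` needs `a` further ones on the first.
    -- A surplus difference costs a factor `2`, so each target term is collected `2 + 1 = 3` times,
    -- whence the powers of `3`.
    rw [Function.iterate_succ_apply, diffOp_mul, diffOp_iterate_add]
    have hφ' := aestronglyMeasurable_translate h hφ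
    have hg' := aestronglyMeasurable_diffOp h hg
    have hφd := aestronglyMeasurable_diffOp h hφ
    have h1 := ih (a + 1) b hφ' hg' (by omega)
    have h2 := ih a (b + 1) hφd hg (by omega)
    refine (eLpNorm_add_le (aestronglyMeasurable_diffOp_iterate h _ (hφ'.mul hg'))
      (aestronglyMeasurable_diffOp_iterate h _ (hφd.mul hg)) one_le_two).trans ?_
    rw [diffOp_iterate_translate, eLpNorm_translate h _
      (aestronglyMeasurable_diffOp_iterate h _ hφ), eLpNorm_translate h _ hφ] at h1
    have e1 : eLpNorm (diffOp h g) 2 volume ≤ 2 * eLpNorm g 2 volume :=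
      eLpNorm_diffOp_le h one_le_two hg
    have e2 : eLpNorm (diffOp h φ) ⊤ volume ≤ 2 * eLpNorm φ ⊤ volume :=
      eLpNorm_diffOp_le h le_top hφ
    rw [← Function.iterate_succ_apply] at h1 h2
    refine (add_le_add h1 h2).trans ?_
    calc _ ≤ 3 ^ n * (eLpNorm ((diffOp h)^[a + 1] φ) ⊤ volume * (2 * eLpNorm g 2 volume) +
            eLpNorm φ ⊤ volume * eLpNorm ((diffOp h)^[b + 1] g) 2 volume) +
          3 ^ n * (eLpNorm ((diffOp h)^[a + 1] φ) ⊤ volume * eLpNorm g 2 volume +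
            2 * eLpNorm φ ⊤ volume * eLpNorm ((diffOp h)^[b + 1] g) 2 volume) := by gcongr
      _ = _ := by ring

theorem lintegral_enorm_sq_eq (u : Phase d → ℂ) :
    ∫⁻ z, ‖u z‖ₑ ^ 2 = eLpNorm u 2 volume ^ 2 := by
  have := eLpNorm_nnreal_pow_eq_lintegral (μ := (volume : Measure (Phase d))) (f := u)
    (p := 2) (by norm_num)
  simpa using this.symm

theorem lintegral_enorm_sq_fourier (g : L2 d) :
    ∫⁻ ζ, ‖(𝓕 g : L2 d) ζ‖ₑ ^ 2 = eLpNorm g 2 volume ^ 2 := by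
  rw [lintegral_enorm_sq_eq, ← Lp.enorm_def, ← Lp.enorm_def, ← ofReal_norm, ← ofReal_norm,
    Lp.norm_fourier_eq]

/-- Each difference multiplies the Fourier transform by `phase h - 1`. Differences act on functions
and `𝓕` on classes, so the `L²` class `G` of the iterated difference is carried through the
induction. -/
theorem exists_diffOp_iterate_fourier (h : Phase d) (m : ℕ) (g : L2 d) :
    ∃ G : L2 d, (diffOp h)^[m] g =ᵐ[volume] G ∧
      (𝓕 G : L2 d) =ᵐ[volume] fun ζ => (phase h ζ - 1) ^ m * (𝓕 g : L2 d) ζ := by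
  induction m generalizing g with
  | zero => exact ⟨g, by simp, by simp⟩
  | succ m ih =>
    set τ := Lp.compMeasurePreserving (· + h) (measurePreserving_add_right volume h) g with hτ
    obtain ⟨G, hG1, hG2⟩ := ih (τ - g)
    refine ⟨G, ?_, ?_⟩
    · refine Filter.EventuallyEq.trans (diffOp_iterate_congr_ae h m ?_) hG1
      filter_upwards [Lp.coeFn_sub τ g, Lp.coeFn_compMeasurePreserving g
          (measurePreserving_add_right volume h)] with z h1 h2
      rw [h1, Pi.sub_apply, h2]
      rfl
    · have h3 : (𝓕 (τ - g) : L2 d) = 𝓕 τ - 𝓕 g := (Lp.fourierTransformₗᵢ _ ℂ).map_sub τ g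
      rw [h3] at hG2
      filter_upwards [hG2, Lp.coeFn_sub (𝓕 τ : L2 d) (𝓕 g), fourier_translate g h]
        with ζ h4 h5 h6
      rw [h4, h5, Pi.sub_apply, h6]
      ring

/-- Plancherel's identity for iterated differences. -/
theorem lintegral_diffOp_iterate (h : Phase d) (m : ℕ) (g : L2 d) :
    ∫⁻ ζ, ‖phase h ζ - 1‖ₑ ^ (2 * m) * ‖(𝓕 g : L2 d) ζ‖ₑ ^ 2 =
      eLpNorm ((diffOp h)^[m] g) 2 volume ^ 2 := by
  obtain ⟨G, hG1, hG2⟩ := exists_diffOp_iterate_fourier h m g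
  rw [eLpNorm_congr_ae hG1, ← lintegral_enorm_sq_fourier]
  refine lintegral_congr_ae ?_
  filter_upwards [hG2] with ζ hζ
  rw [hζ, enorm_mul, mul_pow, enorm_pow, ← pow_mul, mul_comm 2 m]

end Differences

/-! ### The kinetic weight and its coordinate sizes -/

section Weights

variable {d : ℕ}

theorem one_le_kinWeight (ζ : Phase d) : 1 ≤ kinWeight ζ := by
  unfold kinWeight
  have h1 : 0 ≤ ‖ζ.fst‖ ^ (2 / 3 : ℝ) := by positivity
  have h2 : 0 ≤ ‖ζ.snd‖ ^ 2 := by positivity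
  linarith

/-- The coordinate vector `4^{-1} 2^{-3n} e_j` in position or `4^{-1} 2^{-n} e_j` in velocity: a
step of kinetic length at most `2^{-n}`. -/
def stepVec (n : ℕ) : Fin d ⊕ Fin d → Phase d
  | .inl j => mkPhase (EuclideanSpace.single j ((1 / 4) * ((2 : ℝ) ^ n)⁻¹ ^ 3)) 0
  | .inr j => mkPhase 0 (EuclideanSpace.single j ((1 / 4) * ((2 : ℝ) ^ n)⁻¹))

theorem stepVec_ne_zero (n : ℕ) (e : Fin d ⊕ Fin d) : stepVec n e ≠ 0 := by
  have h2 : (2 : ℝ) ^ n ≠ 0 := by positivity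
  intro h
  rcases e with j | j
  · have := congrArg (fun z : Phase d => z.fst j) h
    simp [stepVec] at this
  · have := congrArg (fun z : Phase d => z.snd j) h
    simp [stepVec] at this

theorem kinLength_nonneg (h : Phase d) : 0 ≤ kinLength h := by
  unfold kinLength; positivity

theorem kinLength_stepVec_le (n : ℕ) (e : Fin d ⊕ Fin d) :
    kinLength (stepVec n e) ≤ ((2 : ℝ) ^ n)⁻¹ := by
  have h2 : 0 < ((2 : ℝ) ^ n)⁻¹ := by positivity
  set y := ((2 : ℝ) ^ n)⁻¹ with hy
  rcases e with j | j
  · simp only [kinLength, stepVec, WithLp.toLp_fst, WithLp.toLp_snd, norm_zero, add_zero,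
      PiLp.norm_single, ← hy]
    rw [Real.norm_of_nonneg (by positivity)]
    calc (1 / 4 * y ^ 3) ^ (1 / 3 : ℝ) ≤ (y ^ 3) ^ (1 / 3 : ℝ) := by
          gcongr
          nlinarith [pow_pos h2 3]
      _ = y := by
          rw [← Real.rpow_natCast, ← Real.rpow_mul h2.le]; norm_num
  · simp only [kinLength, stepVec, WithLp.toLp_fst, WithLp.toLp_snd, norm_zero,
      PiLp.norm_single, ← hy]
    rw [Real.norm_of_nonneg (by positivity), Real.zero_rpow (by norm_num)]
    linarith

/-- The kinetic size of a coordinate. -/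
def coordSize (ω : Phase d) : Fin d ⊕ Fin d → ℝ
  | .inl j => |ω.fst j| ^ (1 / 3 : ℝ)
  | .inr j => |ω.snd j|

theorem coordSize_nonneg (ω : Phase d) (e : Fin d ⊕ Fin d) : 0 ≤ coordSize ω e := by
  rcases e with j | j <;> simp only [coordSize] <;> positivity

/-- The angle `2π h·ζ` for `h = stepVec n e`, up to sign. -/
theorem norm_phase_stepVec (n : ℕ) (e : Fin d ⊕ Fin d) (ζ : Phase d) :
    ∃ θ : ℝ, ‖phase (stepVec n e) ζ - 1‖ = ‖2 * Real.sin (θ / 2)‖ ∧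
      ((|θ| = 1 / 4 * (((2 : ℝ) ^ n)⁻¹ * coordSize ((2 * Real.pi) • ζ) e) ^ 3) ∨
       (|θ| = 1 / 4 * (((2 : ℝ) ^ n)⁻¹ * coordSize ((2 * Real.pi) • ζ) e))) := by
  have h2 : 0 < ((2 : ℝ) ^ n)⁻¹ := by positivity
  refine ⟨2 * Real.pi * inner ℝ (stepVec n e) ζ, ?_, ?_⟩
  · rw [phase, mul_comm _ Complex.I, Complex.norm_exp_I_mul_ofReal_sub_one]
  · set y := ((2 : ℝ) ^ n)⁻¹ with hy
    rcases e with j | j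
    -- The cubic alternative belongs to the position directions, whose step scales like `2^(-3n)`
    -- and whose coordinate is the cube of its kinetic size.
    · left
      have : inner ℝ (stepVec n (Sum.inl j)) ζ = 1 / 4 * y ^ 3 * ζ.fst j := by
        simp [stepVec, WithLp.prod_inner_apply, EuclideanSpace.inner_single_left, hy]
      rw [this, mul_pow, coordSize, ← Real.rpow_natCast (_ ^ (1/3 : ℝ)), ← Real.rpow_mul (abs_nonneg _)]
      norm_num
      rw [abs_of_pos Real.pi_pos, abs_of_pos h2]
      ring
    · right
      have : inner ℝ (stepVec n (Sum.inr j)) ζ = 1 / 4 * y * ζ.snd j := by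
        simp [stepVec, WithLp.prod_inner_apply, EuclideanSpace.inner_single_left, hy]
      rw [this, coordSize]
      simp only [abs_mul, WithLp.smul_snd, PiLp.smul_apply, smul_eq_mul]
      rw [abs_of_pos Real.pi_pos, abs_of_pos h2]
      norm_num
      ring

theorem coordSize_le (ω : Phase d) (e : Fin d ⊕ Fin d) : coordSize ω e ^ 2 ≤ kinWeight ω := by
  unfold kinWeight
  have h1 : 0 ≤ ‖ω.fst‖ ^ (2 / 3 : ℝ) := by positivity
  have h2 : 0 ≤ ‖ω.snd‖ ^ 2 := by positivity
  rcases e with j | j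
  · have h : |ω.fst j| ≤ ‖ω.fst‖ := PiLp.norm_apply_le ω.fst j
    have : coordSize ω (.inl j) ^ 2 ≤ ‖ω.fst‖ ^ (2 / 3 : ℝ) := by
      rw [coordSize, ← Real.rpow_natCast, ← Real.rpow_mul (abs_nonneg _)]
      norm_num
      gcongr
    linarith
  · have h : |ω.snd j| ≤ ‖ω.snd‖ := PiLp.norm_apply_le ω.snd j
    have : coordSize ω (.inr j) ^ 2 ≤ ‖ω.snd‖ ^ 2 := by
      rw [coordSize]; gcongr
    linarith

/-- Position coordinates are at most `R³`, hence `|ξ|² ≤ d R⁶` and `|ξ|^(2/3) ≤ d R²`; velocity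
coordinates give `|η|² ≤ d R²`, and the summand `1` is at most `R²`. -/
theorem kinWeight_le_of_coordSize_le {ω : Phase d} {R : ℝ} (hR : 1 ≤ R)
    (h : ∀ e, coordSize ω e ≤ R) : kinWeight ω ≤ (1 + 2 * d) * R ^ 2 := by
  have hx : ‖ω.fst‖ ^ 2 ≤ d * (R ^ 3) ^ 2 := by
    rw [EuclideanSpace.norm_sq_eq]
    calc _ ≤ ∑ j : Fin d, (R ^ 3) ^ 2 := by
          refine Finset.sum_le_sum fun j _ => ?_
          have h1 := h (.inl j)
          rw [Real.norm_eq_abs]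
          have h3 : |ω.fst j| = (|ω.fst j| ^ (1 / 3 : ℝ)) ^ 3 := by
            rw [← Real.rpow_natCast, ← Real.rpow_mul (abs_nonneg _)]; norm_num
          rw [h3]
          gcongr
          exact h1
      _ = _ := by simp
  have hv : ‖ω.snd‖ ^ 2 ≤ d * R ^ 2 := by
    rw [EuclideanSpace.norm_sq_eq]
    calc _ ≤ ∑ j : Fin d, R ^ 2 := by
          refine Finset.sum_le_sum fun j _ => ?_
          have h1 := h (.inr j)
          rw [Real.norm_eq_abs]
          gcongr
          exact h1
      _ = _ := by simp
  have hx' : ‖ω.fst‖ ^ (2 / 3 : ℝ) ≤ d * R ^ 2 := by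
    rcases Nat.eq_zero_or_pos d with rfl | hd
    · have : ω.fst = 0 := Subsingleton.elim _ _
      simp [this]
    have hd' : (1 : ℝ) ≤ d := by exact_mod_cast hd
    have : ‖ω.fst‖ ≤ (d * R ^ 2) ^ (3 / 2 : ℝ) := by
      rw [← abs_of_nonneg (norm_nonneg ω.fst), ← Real.sqrt_sq_eq_abs]
      rw [show (3 / 2 : ℝ) = 3 * (1 / 2) by norm_num, Real.rpow_mul (by positivity),
        ← Real.sqrt_eq_rpow]
      refine Real.sqrt_le_sqrt (hx.trans ?_)
      rw [show (3 : ℝ) = (3 : ℕ) by norm_num, Real.rpow_natCast, mul_pow]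
      have : (d : ℝ) ≤ d ^ 3 := le_self_pow₀ hd' (by norm_num)
      calc (d : ℝ) * (R ^ 3) ^ 2 ≤ d ^ 3 * (R ^ 3) ^ 2 := by gcongr
        _ = _ := by ring
    calc _ ≤ ((d * R ^ 2) ^ (3 / 2 : ℝ)) ^ (2 / 3 : ℝ) := by gcongr
      _ = _ := by rw [← Real.rpow_mul (by positivity)]; norm_num
  unfold kinWeight
  nlinarith [one_le_pow₀ hR (n := 2)]

end Weights

/-! ### Dyadic oscillation sums compared with the kinetic weight -/

section Oscillation

variable {d : ℕ}

theorem norm_phase_stepVec_sub_one_le (n : ℕ) (e : Fin d ⊕ Fin d) (ζ : Phase d) {ρ : ℝ}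
    (hρ : coordSize ((2 * Real.pi) • ζ) e ≤ ρ) :
    ‖phase (stepVec n e) ζ - 1‖ ≤ 2 * min 1 (((2 : ℝ) ^ n)⁻¹ * ρ) := by
  have h2 : 0 < ((2 : ℝ) ^ n)⁻¹ := by positivity
  obtain ⟨θ, h, hθ⟩ := norm_phase_stepVec n e ζ
  have hc := coordSize_nonneg ((2 * Real.pi) • ζ) e
  set c := coordSize ((2 * Real.pi) • ζ) e
  set y := ((2 : ℝ) ^ n)⁻¹
  have hyc : 0 ≤ y * c := by positivity
  have hyρ : y * c ≤ y * ρ := by gcongr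
  rw [h, Real.norm_eq_abs, abs_mul, abs_two]
  gcongr
  refine le_min (Real.abs_sin_le_one _) ?_
  rcases le_or_gt 1 (y * ρ) with h1 | h1
  · exact (Real.abs_sin_le_one _).trans h1
  · have h3 : |Real.sin (θ / 2)| ≤ |θ / 2| := Real.abs_sin_le_abs
    rw [abs_div, abs_two] at h3
    -- Below size `1` the cubic angle of a position direction is dominated by the linear one, so one
    -- bound serves both kinds of direction.
    have h4 : (y * c) ^ 3 ≤ y * c := pow_le_of_le_one hyc (by linarith) (by norm_num)
    rcases hθ with h5 | h5 <;> linarith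

/-- The factor `1/4` in `stepVec` is chosen for this bound: even the cubic angle `r³ / 4` with `r ≤
2` is at most `2 < π`, so the sine stays in the range where it is bounded below by a multiple of its
argument. -/
theorem le_norm_phase_stepVec_sub_one (n : ℕ) (e : Fin d ⊕ Fin d) (ζ : Phase d)
    (h1 : 1 ≤ ((2 : ℝ) ^ n)⁻¹ * coordSize ((2 * Real.pi) • ζ) e)
    (h2 : ((2 : ℝ) ^ n)⁻¹ * coordSize ((2 * Real.pi) • ζ) e ≤ 2) :
    1 / 8 ≤ ‖phase (stepVec n e) ζ - 1‖ := by
  obtain ⟨θ, h, hθ⟩ := norm_phase_stepVec n e ζ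
  set r := ((2 : ℝ) ^ n)⁻¹ * coordSize ((2 * Real.pi) • ζ) e
  have h3 : 1 ≤ r ^ 3 := one_le_pow₀ h1
  have h4 : r ^ 3 ≤ 2 ^ 3 := by gcongr
  have hlo : 1 / 4 ≤ |θ| := by rcases hθ with h5 | h5 <;> linarith
  have hhi : |θ| ≤ 2 := by rcases hθ with h5 | h5 <;> linarith
  have hpi := Real.pi_gt_three
  have hpi' := Real.pi_lt_four
  have hs : 2 / Real.pi * |θ / 2| ≤ |Real.sin (θ / 2)| := by
    rw [abs_div, abs_two]
    have := Real.mul_le_sin (x := |θ| / 2) (by positivity) (by linarith)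
    refine this.trans ?_
    rcases abs_cases θ with ⟨h, _⟩ | ⟨h, _⟩
    · rw [h]; exact le_abs_self _
    · rw [h, neg_div, Real.sin_neg]; exact neg_le_abs _
  rw [h, Real.norm_eq_abs, abs_mul, abs_two]
  rw [abs_div, abs_two] at hs
  have h6 : 1 / 2 ≤ 2 / Real.pi := by
    rw [div_le_div_iff₀ (by norm_num) Real.pi_pos]; linarith
  have h7 : 1 / 2 * (1 / 4 / 2) ≤ 2 / Real.pi * (|θ| / 2) := by gcongr
  linarith

theorem exists_two_pow_le (ρ : ℝ) (hρ : 1 ≤ ρ) : ∃ N : ℕ, (2 : ℝ) ^ N ≤ ρ ∧ ρ < 2 ^ (N + 1) :=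
  exists_nat_pow_near hρ one_lt_two

theorem two_pow_rpow (n : ℕ) (t : ℝ) : ((2 : ℝ) ^ n) ^ t = ((2 : ℝ) ^ t) ^ n := by
  rw [← Real.rpow_natCast, ← Real.rpow_natCast, ← Real.rpow_mul (by norm_num),
    ← Real.rpow_mul (by norm_num), mul_comm]

/-- The dyadic sum `∑ₙ 2^{2ns} min(1, 2^{-n} ρ)^{2M}` is of order `ρ^{2s}` when `0 < s < M`. -/
theorem exists_dyadic_sum_le {s : ℝ} (hs : 0 < s) {M : ℕ} (hM : s < M) :
    ∃ C : ℝ≥0∞, C ≠ ⊤ ∧ ∀ ρ : ℝ, 1 ≤ ρ →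
      ∑' n : ℕ, ENNReal.ofReal (((2 : ℝ) ^ (2 * s)) ^ n * min 1 (((2 : ℝ) ^ n)⁻¹ * ρ) ^ (2 * M)) ≤
        C * ENNReal.ofReal (ρ ^ (2 * s)) := by
  obtain ⟨q, hq⟩ : ∃ q : ℝ, q = (2 : ℝ) ^ (2 * s) := ⟨_, rfl⟩
  rw [← hq]
  have hq1 : 1 < q := hq ▸ Real.one_lt_rpow one_lt_two (by positivity)
  have hq0 : 0 < q := by linarith
  -- Ratio of the geometric series beyond `2^n ≈ ρ`; it is below `1` exactly because `s < M`.
  obtain ⟨p, hp⟩ : ∃ p : ℝ, p = q * (4 ^ M)⁻¹ := ⟨_, rfl⟩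
  have hp0 : 0 ≤ p := hp ▸ by positivity
  have hp1 : p < 1 := by
    rw [hp, ← div_eq_mul_inv, div_lt_one (by positivity), hq,
      show (4 : ℝ) = 2 ^ (2 : ℝ) by norm_num, ← Real.rpow_natCast, ← Real.rpow_mul (by norm_num)]
    exact Real.rpow_lt_rpow_of_exponent_lt one_lt_two (by linarith)
  have hA : ∑' k : ℕ, ENNReal.ofReal (q⁻¹ ^ k) ≠ ⊤ := (summable_geometric_of_lt_one (by positivity)
    (inv_lt_one_of_one_lt₀ hq1)).tsum_ofReal_ne_top
  have hB : ∑' k : ℕ, ENNReal.ofReal (q * p ^ k) ≠ ⊤ := ((summable_geometric_of_lt_one hp0 hp1).mul_left q).tsum_ofReal_ne_top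
  refine ⟨_, ENNReal.add_ne_top.mpr ⟨hA, hB⟩, fun ρ hρ => ?_⟩
  obtain ⟨N, hN1, hN2⟩ := exists_two_pow_le ρ hρ
  have hqN : q ^ N ≤ ρ ^ (2 * s) := by
    rw [hq, ← two_pow_rpow]
    exact Real.rpow_le_rpow (by positivity) hN1 (by positivity)
  -- The sum is cut where `2^n` passes `ρ`. Up to `N` the minimum is replaced by `1` and the terms
  -- decay by `q⁻¹` counting down from `N`; after `N` the minimum is at most `2^(-k)` for `n = k + N
  -- + 1`.
  rw [← Summable.sum_add_tsum_nat_add' (k := N + 1) ENNReal.summable, add_mul]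
  refine add_le_add ?_ ?_
  · rw [← Finset.sum_range_reflect]
    calc _ ≤ ∑ k ∈ Finset.range (N + 1), ENNReal.ofReal (q⁻¹ ^ k) * ENNReal.ofReal (ρ ^ (2 * s)) := by
          refine Finset.sum_le_sum fun k hk => ?_
          rw [← ENNReal.ofReal_mul (by positivity)]
          refine ENNReal.ofReal_le_ofReal ?_
          have hk' : k ≤ N := by simpa [Nat.lt_succ_iff] using hk
          have hmin : min 1 (((2 : ℝ) ^ (N + 1 - 1 - k))⁻¹ * ρ) ^ (2 * M) ≤ 1 :=
            pow_le_one₀ (le_min zero_le_one (by positivity)) (min_le_left _ _)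
          calc _ ≤ q ^ (N + 1 - 1 - k) * 1 := by gcongr
            _ = q⁻¹ ^ k * q ^ N := by
              rw [mul_one, Nat.add_sub_cancel, inv_pow, pow_sub₀ _ hq0.ne' hk', mul_comm]
            _ ≤ _ := by gcongr
      _ = (∑ k ∈ Finset.range (N + 1), ENNReal.ofReal (q⁻¹ ^ k)) * ENNReal.ofReal (ρ ^ (2 * s)) :=
          (Finset.sum_mul _ _ _).symm
      _ ≤ _ := by gcongr; exact ENNReal.sum_le_tsum _
  · rw [← ENNReal.tsum_mul_right]
    refine ENNReal.tsum_le_tsum fun k => ?_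
    rw [← ENNReal.ofReal_mul (by positivity)]
    refine ENNReal.ofReal_le_ofReal ?_
    have hmin : min 1 (((2 : ℝ) ^ (k + (N + 1)))⁻¹ * ρ) ≤ ((2 : ℝ) ^ k)⁻¹ := by
      refine (min_le_right _ _).trans ?_
      rw [pow_add, mul_inv, mul_assoc]
      refine mul_le_of_le_one_right (by positivity) ?_
      rw [inv_mul_le_iff₀ (by positivity), mul_one]
      exact hN2.le
    have h0 : 0 ≤ min 1 (((2 : ℝ) ^ (k + (N + 1)))⁻¹ * ρ) := le_min zero_le_one (by positivity)
    calc _ ≤ q ^ (k + (N + 1)) * (((2 : ℝ) ^ k)⁻¹) ^ (2 * M) := by gcongr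
      _ = q * p ^ k * q ^ N := by
        have h4 : (((2 : ℝ) ^ k)⁻¹) ^ (2 * M) = ((4 ^ M)⁻¹) ^ k := by
          rw [inv_pow, inv_pow, ← pow_mul, ← pow_mul, show (4 : ℝ) = 2 ^ 2 by norm_num, ← pow_mul]
          congr 2; ring
        rw [h4, hp, mul_pow]; ring
      _ ≤ _ := by gcongr

/-- The square function of oscillations `∑ₙ ∑ₑ 2^{2ns} |exp(2πi h·ζ) - 1|^{2m}`, `h = stepVec n e`,
the Fourier symbol of a discretized difference norm of order `s`. -/
def oscSum (s : ℝ) (m : ℕ) (ζ : Phase d) : ℝ≥0∞ :=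
  ∑' n : ℕ, ∑ e : Fin d ⊕ Fin d,
    ENNReal.ofReal (((2 : ℝ) ^ (2 * s)) ^ n) * ‖phase (stepVec n e) ζ - 1‖ₑ ^ (2 * m)

/-- Every coordinate has kinetic size at most `ρ`, the square root of the weight, so each direction
contributes at most a dyadic sum of order `ρ^(2s)`. -/
theorem exists_oscSum_le (d : ℕ) {s : ℝ} (hs : 0 < s) {M : ℕ} (hM : s < M) :
    ∃ C : ℝ≥0∞, C ≠ ⊤ ∧ ∀ ζ : Phase d,
      oscSum s M ζ ≤ C * ENNReal.ofReal (kinWeight ((2 * Real.pi) • ζ) ^ s) := by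
  obtain ⟨C, hC, h⟩ := exists_dyadic_sum_le hs hM
  refine ⟨(2 * d : ℕ) * 2 ^ (2 * M) * C, by finiteness, fun ζ => ?_⟩
  set W := kinWeight ((2 * Real.pi) • ζ) with hW
  have hW1 : 1 ≤ W := one_le_kinWeight _
  have hρ1 : 1 ≤ W ^ (1 / 2 : ℝ) := Real.one_le_rpow hW1 (by norm_num)
  have hρs : (W ^ (1 / 2 : ℝ)) ^ (2 * s) = W ^ s := by
    rw [← Real.rpow_mul (by linarith)]; congr 1; ring
  have h1 := h _ hρ1
  rw [hρs] at h1
  have hterm : ∀ (n : ℕ) (e : Fin d ⊕ Fin d),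
      ENNReal.ofReal (((2 : ℝ) ^ (2 * s)) ^ n) * ‖phase (stepVec n e) ζ - 1‖ₑ ^ (2 * M) ≤
      2 ^ (2 * M) * ENNReal.ofReal (((2 : ℝ) ^ (2 * s)) ^ n *
        min 1 (((2 : ℝ) ^ n)⁻¹ * W ^ (1 / 2 : ℝ)) ^ (2 * M)) := fun n e => by
    have hc : coordSize ((2 * Real.pi) • ζ) e ≤ W ^ (1 / 2 : ℝ) := by
      rw [← Real.sqrt_eq_rpow]
      exact Real.le_sqrt_of_sq_le (coordSize_le _ e)
    have h2 := norm_phase_stepVec_sub_one_le n e ζ hc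
    have h0 : 0 ≤ min 1 (((2 : ℝ) ^ n)⁻¹ * W ^ (1 / 2 : ℝ)) := le_min zero_le_one (by positivity)
    rw [← ofReal_norm, ← ENNReal.ofReal_pow (norm_nonneg _), ← ENNReal.ofReal_mul (by positivity),
      show (2 : ℝ≥0∞) ^ (2 * M) = ENNReal.ofReal (2 ^ (2 * M)) by
        rw [ENNReal.ofReal_pow (by norm_num)]; norm_num, ← ENNReal.ofReal_mul (by positivity)]
    refine ENNReal.ofReal_le_ofReal ?_
    calc _ ≤ ((2 : ℝ) ^ (2 * s)) ^ n *
          (2 * min 1 (((2 : ℝ) ^ n)⁻¹ * W ^ (1 / 2 : ℝ))) ^ (2 * M) := by gcongr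
      _ = _ := by rw [mul_pow]; ring
  calc oscSum s M ζ ≤ ∑' n : ℕ, ∑ _e : Fin d ⊕ Fin d,
        2 ^ (2 * M) * ENNReal.ofReal (((2 : ℝ) ^ (2 * s)) ^ n *
        min 1 (((2 : ℝ) ^ n)⁻¹ * W ^ (1 / 2 : ℝ)) ^ (2 * M)) :=
      ENNReal.tsum_le_tsum fun n => Finset.sum_le_sum fun e _ => hterm n e
    _ = (2 * d : ℕ) * 2 ^ (2 * M) * ∑' n : ℕ, ENNReal.ofReal (((2 : ℝ) ^ (2 * s)) ^ n *
        min 1 (((2 : ℝ) ^ n)⁻¹ * W ^ (1 / 2 : ℝ)) ^ (2 * M)) := by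
      simp only [Finset.sum_const, nsmul_eq_mul, ENNReal.tsum_mul_left, Finset.card_univ,
        Fintype.card_sum, Fintype.card_fin, ← two_mul, mul_assoc]
    _ ≤ (2 * d : ℕ) * 2 ^ (2 * M) * (C * ENNReal.ofReal (W ^ s)) := by gcongr
    _ = _ := by ring

/-- One term of the sum suffices: take the largest coordinate and the scale `2^n` comparable to its
size, where the oscillation is at least `1/8`. Low frequencies are covered by the summand `1`. No
relation between `m` and `s` is needed in this direction. -/
theorem exists_kinWeight_le_oscSum (d : ℕ) {s : ℝ} (hs : 0 < s) (m : ℕ) :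
    ∃ C : ℝ≥0∞, C ≠ ⊤ ∧ ∀ ζ : Phase d,
      ENNReal.ofReal (kinWeight ((2 * Real.pi) • ζ) ^ s) ≤ C * (1 + oscSum s m ζ) := by
  set A : ℝ := (1 + 2 * d) ^ s with hA
  set q : ℝ := (2 : ℝ) ^ (2 * s) with hq
  have hA0 : 0 ≤ A := by positivity
  have hq1 : 1 ≤ q := Real.one_le_rpow one_le_two (by positivity)
  refine ⟨ENNReal.ofReal (A * q * 8 ^ (2 * m)), by finiteness, fun ζ => ?_⟩
  set ω := (2 * Real.pi) • ζ with hω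
  have hW0 : 0 ≤ kinWeight ω := zero_le_one.trans (one_le_kinWeight _)
  by_cases hall : ∀ e, coordSize ω e ≤ 1
  · have h1 := kinWeight_le_of_coordSize_le le_rfl hall
    rw [one_pow, mul_one] at h1
    have h2 : kinWeight ω ^ s ≤ A * q * 8 ^ (2 * m) := by
      calc _ ≤ A := Real.rpow_le_rpow hW0 h1 hs.le
        _ ≤ A * q := le_mul_of_one_le_right hA0 hq1
        _ ≤ _ := le_mul_of_one_le_right (by positivity) (one_le_pow₀ (by norm_num))
    calc _ ≤ ENNReal.ofReal (A * q * 8 ^ (2 * m)) := ENNReal.ofReal_le_ofReal h2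
      _ ≤ _ := le_mul_of_one_le_right' le_self_add
  · push Not at hall
    obtain ⟨e', he'⟩ := hall
    obtain ⟨e, -, he⟩ := Finset.exists_max_image Finset.univ (coordSize ω) ⟨e', Finset.mem_univ _⟩
    set R := coordSize ω e with hR
    have hR1 : 1 ≤ R := he'.le.trans (he e' (Finset.mem_univ _))
    have h1 := kinWeight_le_of_coordSize_le hR1 fun e'' => he e'' (Finset.mem_univ _)
    obtain ⟨n, hn1, hn2⟩ := exists_two_pow_le R hR1
    have h3 := le_norm_phase_stepVec_sub_one n e ζ
      (by rw [← hω, ← hR, ← div_eq_inv_mul, one_le_div (by positivity)]; exact hn1)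
      (by rw [← hω, ← hR, ← div_eq_inv_mul, div_le_iff₀ (by positivity)]
          rw [pow_succ] at hn2; linarith)
    have h4 : kinWeight ω ^ s ≤ A * (q * q ^ n) := by
      calc _ ≤ ((1 + 2 * d) * R ^ 2) ^ s := Real.rpow_le_rpow hW0 h1 hs.le
        _ = A * (R ^ 2) ^ s := Real.mul_rpow (by positivity) (by positivity)
        _ ≤ A * (((2 : ℝ) ^ (n + 1)) ^ 2) ^ s := by gcongr
        _ = A * (q * q ^ n) := by
          rw [← pow_succ', hq, ← two_pow_rpow, Real.rpow_mul (by positivity), Real.rpow_two]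
    have h5 : kinWeight ω ^ s ≤
        A * q * 8 ^ (2 * m) * (q ^ n * ‖phase (stepVec n e) ζ - 1‖ ^ (2 * m)) := by
      have h6 : 1 ≤ (8 * ‖phase (stepVec n e) ζ - 1‖) ^ (2 * m) := one_le_pow₀ (by linarith)
      calc _ ≤ A * (q * q ^ n) * 1 := by rw [mul_one]; exact h4
        _ ≤ A * (q * q ^ n) * (8 * ‖phase (stepVec n e) ζ - 1‖) ^ (2 * m) := by gcongr
        _ = _ := by rw [mul_pow]; ring
    refine (ENNReal.ofReal_le_ofReal h5).trans ?_
    rw [ENNReal.ofReal_mul (by positivity)]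
    gcongr
    rw [ENNReal.ofReal_mul (by positivity), ENNReal.ofReal_pow (norm_nonneg _), ofReal_norm]
    refine le_trans ?_ le_add_self
    refine le_trans ?_ (ENNReal.le_tsum n)
    exact Finset.single_le_sum (f := fun e => ENNReal.ofReal (q ^ n) *
      ‖phase (stepVec n e) ζ - 1‖ₑ ^ (2 * m)) (fun _ _ => zero_le) (Finset.mem_univ e)

end Oscillation

/-! ### Sobolev energy by differences, and Hölder multipliers -/

section Multiplication

variable {d : ℕ}

theorem continuous_kinWeight : Continuous (kinWeight : Phase d → ℝ) := by
  unfold kinWeight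
  have h1 : Continuous fun ζ : Phase d => ζ.fst := (WithLp.continuous_fst ..)
  have h2 : Continuous fun ζ : Phase d => ζ.snd := (WithLp.continuous_snd ..)
  exact (continuous_const.add (h1.norm.rpow_const fun _ => Or.inr (by norm_num))).add
    (h2.norm.pow 2)

theorem continuous_sobWeight (s : ℝ) : Continuous (sobWeight s : Phase d → ℝ) := by
  unfold sobWeight
  refine continuous_const.mul ((continuous_kinWeight.comp (continuous_const_smul _)).rpow_const
    fun ζ => Or.inl ?_)
  exact (zero_lt_one.trans_le (one_le_kinWeight _)).ne'

theorem aestronglyMeasurable_weightedFourier (s : ℝ) (f : L2 d) :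
    AEStronglyMeasurable (weightedFourier s f) volume :=
  (continuous_sobWeight s).aestronglyMeasurable.smul (Lp.aestronglyMeasurable _)

/-- The Sobolev energy `∫ (1 + |ξ|^{2/3} + |η|²)^s |f^|²`, up to normalization. -/
def sobEnergy (s : ℝ) (f : L2 d) : ℝ≥0∞ :=
  ∫⁻ ζ, ENNReal.ofReal (kinWeight ((2 * Real.pi) • ζ) ^ s) * ‖(𝓕 f : L2 d) ζ‖ₑ ^ 2

/-- The factor `(2π)^(2d)` is common to all elements of `H^s_k`, so norm estimates can be proved for
`sobEnergy`. -/
theorem eLpNorm_weightedFourier_sq (s : ℝ) (f : L2 d) :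
    eLpNorm (weightedFourier s f) 2 volume ^ 2 =
      ENNReal.ofReal (((2 * Real.pi) ^ d) ^ 2) * sobEnergy s f := by
  have hpi := Real.pi_pos
  rw [← lintegral_enorm_sq_eq, sobEnergy, ← lintegral_const_mul' _ _ ENNReal.ofReal_ne_top]
  refine lintegral_congr fun ζ => ?_
  have hW := zero_le_one.trans (one_le_kinWeight ((2 * Real.pi) • ζ))
  rw [weightedFourier, enorm_smul, mul_pow, ← mul_assoc, ← ENNReal.ofReal_mul (by positivity),
    Real.enorm_of_nonneg (sobWeight_pos s ζ).le, ← ENNReal.ofReal_pow (sobWeight_pos s ζ).le,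
    sobWeight, mul_pow, ← Real.rpow_natCast (_ ^ (s / 2)), ← Real.rpow_mul hW]
  norm_num

theorem mem_sobSubmodule_iff {s : ℝ} {f : L2 d} : f ∈ sobSubmodule d s ↔ sobEnergy s f < ⊤ := by
  have hpi := Real.pi_pos
  have h := eLpNorm_weightedFourier_sq s f
  have h0 : ENNReal.ofReal (((2 * Real.pi) ^ d) ^ 2) ≠ 0 := by
    rw [Ne, ENNReal.ofReal_eq_zero, not_le]; positivity
  constructor
  · intro hf
    have h1 : eLpNorm (weightedFourier s f) 2 volume ^ 2 < ⊤ := ENNReal.pow_lt_top hf.2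
    rw [h] at h1
    exact ENNReal.lt_top_of_mul_ne_top_right h1.ne h0
  · intro hf
    refine ⟨aestronglyMeasurable_weightedFourier s f, ?_⟩
    have h1 : eLpNorm (weightedFourier s f) 2 volume ^ 2 < ⊤ :=
      h ▸ ENNReal.mul_lt_top ENNReal.ofReal_lt_top hf
    simpa [ENNReal.pow_lt_top_iff] using h1

theorem HSob.enorm_sq {s : ℝ} (f : HSob d s) :
    ‖f‖ₑ ^ 2 = ENNReal.ofReal (((2 * Real.pi) ^ d) ^ 2) * sobEnergy s f.toL2 := by
  rw [← eLpNorm_weightedFourier_sq]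
  congr 1
  have h1 : ‖f‖ₑ = ‖HSob.toWeighted d s f‖ₑ := rfl
  rw [h1, Lp.enorm_def]
  exact eLpNorm_congr_ae (MemLp.coeFn_toLp f.2)

theorem eLpNorm_sq_le_sobEnergy {s : ℝ} (hs : 0 ≤ s) (f : L2 d) :
    eLpNorm f 2 volume ^ 2 ≤ sobEnergy s f := by
  rw [← lintegral_enorm_sq_fourier]
  refine lintegral_mono fun ζ => ?_
  refine le_mul_of_one_le_left' ?_
  rw [← ENNReal.ofReal_one]
  exact ENNReal.ofReal_le_ofReal (Real.one_le_rpow (one_le_kinWeight _) hs)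

theorem lintegral_oscSum (s : ℝ) (m : ℕ) (f : L2 d) :
    ∫⁻ ζ, oscSum s m ζ * ‖(𝓕 f : L2 d) ζ‖ₑ ^ 2 =
      ∑' n : ℕ, ∑ e : Fin d ⊕ Fin d, ENNReal.ofReal (((2 : ℝ) ^ (2 * s)) ^ n) *
        eLpNorm ((diffOp (stepVec n e))^[m] f) 2 volume ^ 2 := by
  have hmeas : ∀ (n : ℕ) (e : Fin d ⊕ Fin d), AEMeasurable (fun ζ : Phase d =>
      ENNReal.ofReal (((2 : ℝ) ^ (2 * s)) ^ n) * ‖phase (stepVec n e) ζ - 1‖ₑ ^ (2 * m) *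
        ‖(𝓕 f : L2 d) ζ‖ₑ ^ 2) volume := fun n e => by
    have h1 : Measurable fun ζ : Phase d => ‖phase (stepVec n e) ζ - 1‖ₑ :=
      ((contDiff_phase (stepVec n e)).continuous.sub continuous_const).enorm.measurable
    exact ((h1.pow_const _).const_mul _).aemeasurable.mul
      ((Lp.aestronglyMeasurable _).enorm.pow_const _)
  simp only [oscSum, ← ENNReal.tsum_mul_right, Finset.sum_mul]
  rw [lintegral_tsum fun n => Finset.aemeasurable_fun_sum _ fun e _ => hmeas n e]
  refine tsum_congr fun n => ?_
  rw [lintegral_finsetSum' _ fun e _ => hmeas n e]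
  refine Finset.sum_congr rfl fun e _ => ?_
  simp only [mul_assoc]
  rw [lintegral_const_mul' _ _ ENNReal.ofReal_ne_top, lintegral_diffOp_iterate]

/-- Integrates the pointwise bound of the weight by `oscSum` against `|𝓕 f|²` and applies Plancherel
to each difference. The order `m` is free, which lets the product estimate use as many differences
as it needs. -/
theorem exists_sobEnergy_le (d : ℕ) {s : ℝ} (hs : 0 < s) (m : ℕ) :
    ∃ C : ℝ≥0∞, C ≠ ⊤ ∧ ∀ f : L2 d, sobEnergy s f ≤ C * (eLpNorm f 2 volume ^ 2 +
      ∑' n : ℕ, ∑ e : Fin d ⊕ Fin d, ENNReal.ofReal (((2 : ℝ) ^ (2 * s)) ^ n) *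
        eLpNorm ((diffOp (stepVec n e))^[m] f) 2 volume ^ 2) := by
  obtain ⟨C, hC, h⟩ := exists_kinWeight_le_oscSum d hs m
  refine ⟨C, hC, fun f => ?_⟩
  rw [← lintegral_oscSum, ← lintegral_enorm_sq_fourier, ← lintegral_add_left'
    ((Lp.aestronglyMeasurable _).enorm.pow_const _), ← lintegral_const_mul' _ _ hC]
  refine lintegral_mono fun ζ => ?_
  calc _ ≤ C * (1 + oscSum s m ζ) * ‖(𝓕 f : L2 d) ζ‖ₑ ^ 2 := by gcongr; exact h ζ
    _ = _ := by ring

theorem exists_sum_diffOp_le_sobEnergy (d : ℕ) {s : ℝ} (hs : 0 < s) {M : ℕ} (hM : s < M) :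
    ∃ C : ℝ≥0∞, C ≠ ⊤ ∧ ∀ f : L2 d,
      ∑' n : ℕ, ∑ e : Fin d ⊕ Fin d, ENNReal.ofReal (((2 : ℝ) ^ (2 * s)) ^ n) *
        eLpNorm ((diffOp (stepVec n e))^[M] f) 2 volume ^ 2 ≤ C * sobEnergy s f := by
  obtain ⟨C, hC, h⟩ := exists_oscSum_le d hs hM
  refine ⟨C, hC, fun f => ?_⟩
  rw [← lintegral_oscSum, sobEnergy, ← lintegral_const_mul' _ _ hC]
  refine lintegral_mono fun ζ => ?_
  rw [← mul_assoc]
  gcongr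
  exact h ζ

theorem add_sq_le_two_mul (a b : ℝ≥0∞) : (a + b) ^ 2 ≤ 2 * (a ^ 2 + b ^ 2) := by
  wlog h : a ≤ b generalizing a b
  · rw [add_comm a b, add_comm (a ^ 2)]
    exact this b a (le_of_not_ge h)
  obtain ⟨c, rfl⟩ := exists_add_of_le h
  calc (a + (a + c)) ^ 2 ≤ (a + (a + c)) ^ 2 + c ^ 2 := le_self_add
    _ = _ := by ring

/-- Functions of kinetic Hölder regularity `α > s` are multipliers of `H^s_k`. -/
theorem exists_sobEnergy_mul_le (d : ℕ) {s α : ℝ} (hs : 0 < s) (hα : s < α) :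
    ∃ C : ℝ≥0∞, C ≠ ⊤ ∧ ∀ (φ : Phase d → ℂ) (g F : L2 d) (K : ℝ≥0∞),
      AEStronglyMeasurable φ volume → eLpNorm φ ⊤ volume ≤ K →
      (∀ h : Phase d, h ≠ 0 → eLpNorm ((diffOp h)^[⌊α⌋₊ + 1] φ) ⊤ volume ≤
        K * ENNReal.ofReal (kinLength h ^ α)) →
      (F =ᵐ[volume] fun z => φ z * g z) → sobEnergy s F ≤ C * K ^ 2 * sobEnergy s g := by
  set N := ⌊α⌋₊ + 1
  obtain ⟨M, hM⟩ := exists_nat_gt s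
  -- With `N + M` differences of the product, either `N = ⌊α⌋₊ + 1` fall on `φ`, as many as its
  -- Hölder norm controls, or `M > s` fall on `g`, as many as its Sobolev energy controls.
  obtain ⟨C₁, hC₁, h₁⟩ := exists_sobEnergy_le d hs (N + M)
  obtain ⟨C₂, hC₂, h₂⟩ := exists_sum_diffOp_le_sobEnergy d hs hM
  -- The dyadic weight `2^(2ns)` against the squared Hölder gain `2^(-2nα)`; the series in `r`
  -- converges because `s < α`.
  obtain ⟨r, hr⟩ : ∃ r : ℝ, r = (2 : ℝ) ^ (2 * s) * ((2 : ℝ) ^ (2 * α))⁻¹ := ⟨_, rfl⟩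
  have hr0 : 0 ≤ r := hr ▸ by positivity
  have hr1 : r < 1 := by
    rw [hr, ← div_eq_mul_inv, div_lt_one (by positivity)]
    exact Real.rpow_lt_rpow_of_exponent_lt one_lt_two (by linarith)
  have hG : ∑' n : ℕ, ENNReal.ofReal (r ^ n) ≠ ⊤ :=
    (summable_geometric_of_lt_one hr0 hr1).tsum_ofReal_ne_top
  set G := ∑' n : ℕ, ENNReal.ofReal (r ^ n)
  refine ⟨C₁ * (1 + 2 * (3 ^ (N + M)) ^ 2 * ((2 * d : ℕ) * G + C₂)), by finiteness,
    fun φ g F K hφ hK hφh hF => ?_⟩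
  have hg : AEStronglyMeasurable g volume := Lp.aestronglyMeasurable g
  have hE := eLpNorm_sq_le_sobEnergy hs.le g
  have hF0 : eLpNorm F 2 volume ^ 2 ≤ K ^ 2 * sobEnergy s g := by
    rw [eLpNorm_congr_ae hF]
    calc _ ≤ (eLpNorm φ ⊤ volume * eLpNorm g 2 volume) ^ 2 := by
          gcongr; exact eLpNorm_mul_le_top_two φ hg
      _ ≤ (K * eLpNorm g 2 volume) ^ 2 := by gcongr
      _ = K ^ 2 * eLpNorm g 2 volume ^ 2 := by ring
      _ ≤ _ := by gcongr
  have hterm : ∀ (n : ℕ) (e : Fin d ⊕ Fin d), ENNReal.ofReal (((2 : ℝ) ^ (2 * s)) ^ n) *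
        eLpNorm ((diffOp (stepVec n e))^[N + M] F) 2 volume ^ 2 ≤
      2 * (3 ^ (N + M)) ^ 2 * K ^ 2 * (ENNReal.ofReal (r ^ n) * sobEnergy s g +
        ENNReal.ofReal (((2 : ℝ) ^ (2 * s)) ^ n) *
          eLpNorm ((diffOp (stepVec n e))^[M] g) 2 volume ^ 2) := fun n e => by
    have hlen : kinLength (stepVec n e) ^ α ≤ (((2 : ℝ) ^ α) ^ n)⁻¹ := by
      calc _ ≤ (((2 : ℝ) ^ n)⁻¹) ^ α :=
            Real.rpow_le_rpow (kinLength_nonneg _) (kinLength_stepVec_le n e) (by linarith)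
        _ = _ := by rw [Real.inv_rpow (by positivity), two_pow_rpow]
    set a := ENNReal.ofReal ((((2 : ℝ) ^ α) ^ n)⁻¹) with ha
    have hqa : ENNReal.ofReal (((2 : ℝ) ^ (2 * s)) ^ n) * a ^ 2 = ENNReal.ofReal (r ^ n) := by
      rw [ha, ← ENNReal.ofReal_pow (by positivity), ← ENNReal.ofReal_mul (by positivity), hr,
        mul_pow, inv_pow, inv_pow, mul_comm 2 α, Real.rpow_mul (by norm_num) α 2, Real.rpow_two,
        ← pow_mul, ← pow_mul, mul_comm n 2]
    have hdiff : eLpNorm ((diffOp (stepVec n e))^[N] φ) ⊤ volume ≤ K * a :=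
      (hφh _ (stepVec_ne_zero n e)).trans (by gcongr; exact ENNReal.ofReal_le_ofReal hlen)
    rw [eLpNorm_congr_ae (diffOp_iterate_congr_ae _ _ hF)]
    calc _ ≤ ENNReal.ofReal (((2 : ℝ) ^ (2 * s)) ^ n) * (3 ^ (N + M) *
            (K * a * eLpNorm g 2 volume +
              K * eLpNorm ((diffOp (stepVec n e))^[M] g) 2 volume)) ^ 2 := by
          gcongr
          refine (eLpNorm_diffOp_iterate_mul_le (stepVec n e) N M hφ hg).trans ?_
          gcongr
      _ = ENNReal.ofReal (((2 : ℝ) ^ (2 * s)) ^ n) * (3 ^ (N + M)) ^ 2 * K ^ 2 *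
            (a * eLpNorm g 2 volume + eLpNorm ((diffOp (stepVec n e))^[M] g) 2 volume) ^ 2 := by
          ring
      _ ≤ ENNReal.ofReal (((2 : ℝ) ^ (2 * s)) ^ n) * (3 ^ (N + M)) ^ 2 * K ^ 2 *
            (2 * ((a * eLpNorm g 2 volume) ^ 2 +
              eLpNorm ((diffOp (stepVec n e))^[M] g) 2 volume ^ 2)) := by
          gcongr
          exact add_sq_le_two_mul _ _
      _ = 2 * (3 ^ (N + M)) ^ 2 * K ^ 2 *
            ((ENNReal.ofReal (((2 : ℝ) ^ (2 * s)) ^ n) * a ^ 2) * eLpNorm g 2 volume ^ 2 +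
            ENNReal.ofReal (((2 : ℝ) ^ (2 * s)) ^ n) *
              eLpNorm ((diffOp (stepVec n e))^[M] g) 2 volume ^ 2) := by ring
      _ ≤ _ := by rw [hqa]; gcongr
  have hsum : ∑' n : ℕ, ∑ e : Fin d ⊕ Fin d, ENNReal.ofReal (((2 : ℝ) ^ (2 * s)) ^ n) *
        eLpNorm ((diffOp (stepVec n e))^[N + M] F) 2 volume ^ 2 ≤
      2 * (3 ^ (N + M)) ^ 2 * K ^ 2 * ((2 * d : ℕ) * G + C₂) * sobEnergy s g := by
    calc _ ≤ ∑' n : ℕ, ∑ e : Fin d ⊕ Fin d, 2 * (3 ^ (N + M)) ^ 2 * K ^ 2 *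
          (ENNReal.ofReal (r ^ n) * sobEnergy s g + ENNReal.ofReal (((2 : ℝ) ^ (2 * s)) ^ n) *
          eLpNorm ((diffOp (stepVec n e))^[M] g) 2 volume ^ 2) :=
          ENNReal.tsum_le_tsum fun n => Finset.sum_le_sum fun e _ => hterm n e
      _ = 2 * (3 ^ (N + M)) ^ 2 * K ^ 2 * ((2 * d : ℕ) * G * sobEnergy s g +
          ∑' n : ℕ, ∑ e : Fin d ⊕ Fin d, ENNReal.ofReal (((2 : ℝ) ^ (2 * s)) ^ n) *
          eLpNorm ((diffOp (stepVec n e))^[M] g) 2 volume ^ 2) := by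
          simp only [← Finset.mul_sum, ENNReal.tsum_mul_left, Finset.sum_add_distrib,
            ENNReal.tsum_add]
          simp only [Finset.sum_const, nsmul_eq_mul, Finset.card_univ, Fintype.card_sum,
            Fintype.card_fin, ← two_mul, ENNReal.tsum_mul_right]
          ring
      _ ≤ 2 * (3 ^ (N + M)) ^ 2 * K ^ 2 * ((2 * d : ℕ) * G * sobEnergy s g +
          C₂ * sobEnergy s g) := by gcongr; exact h₂ g
      _ = _ := by ring
  calc _ ≤ C₁ * (K ^ 2 * sobEnergy s g +
        2 * (3 ^ (N + M)) ^ 2 * K ^ 2 * ((2 * d : ℕ) * G + C₂) * sobEnergy s g) :=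
        (h₁ F).trans (by gcongr)
    _ = _ := by ring

end Multiplication

/-! ### The kinetic Gaussian kernel and its Fourier transform -/

section Kernel

variable {d : ℕ}

theorem integrable_exp_neg_mul_norm_sq {E : Type*} [NormedAddCommGroup E] [InnerProductSpace ℝ E]
    [FiniteDimensional ℝ E] [MeasurableSpace E] [BorelSpace E] {c : ℝ} (hc : 0 < c) :
    Integrable fun z : E => Real.exp (-c * ‖z‖ ^ 2) := by
  have h := (GaussianFourier.integrable_cexp_neg_mul_sq_norm_add (V := E) (b := (c : ℂ))
    (by simpa using hc) 0 0).norm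
  refine h.congr (Filter.Eventually.of_forall fun z => ?_)
  simp [Complex.norm_exp, ← Complex.ofReal_pow]

theorem integrable_of_gaussian_bound {E : Type*} [NormedAddCommGroup E] [InnerProductSpace ℝ E]
    [FiniteDimensional ℝ E] [MeasurableSpace E] [BorelSpace E] {c C : ℝ} (hc : 0 < c)
    {u : E → ℂ} (hu : Continuous u) (h : ∀ z, ‖u z‖ ≤ C * Real.exp (-c * ‖z‖ ^ 2)) :
    Integrable u :=
  ((integrable_exp_neg_mul_norm_sq hc).const_mul C).mono' hu.aestronglyMeasurable
    (Filter.Eventually.of_forall h)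

theorem memLp_two_of_gaussian_bound {E : Type*} [NormedAddCommGroup E] [InnerProductSpace ℝ E]
    [FiniteDimensional ℝ E] [MeasurableSpace E] [BorelSpace E] {c C : ℝ} (hc : 0 < c)
    {u : E → ℂ} (hu : Continuous u) (h : ∀ z, ‖u z‖ ≤ C * Real.exp (-c * ‖z‖ ^ 2)) :
    MemLp u 2 volume := by
  rw [memLp_two_iff_integrable_sq_norm hu.aestronglyMeasurable]
  refine ((integrable_exp_neg_mul_norm_sq (E := E) (c := 2 * c) (by positivity)).const_mul
    (C ^ 2)).mono' (hu.norm.pow 2).aestronglyMeasurable (Filter.Eventually.of_forall fun z => ?_)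
  rw [Real.norm_of_nonneg (by positivity)]
  calc _ ≤ (C * Real.exp (-c * ‖z‖ ^ 2)) ^ 2 := by gcongr; exact h z
    _ = _ := by rw [mul_pow, ← Real.exp_nat_mul]; congr 2; push_cast; ring

theorem continuous_phase_fst : Continuous fun z : Phase d => z.fst := WithLp.continuous_fst ..

theorem continuous_phase_snd : Continuous fun z : Phase d => z.snd := WithLp.continuous_snd ..

theorem continuous_kinKernel (t : ℝ) : Continuous (kinKernel t : Phase d → ℝ) := by
  unfold kinKernel
  have h1 := continuous_phase_fst (d := d)
  have h2 := continuous_phase_snd (d := d)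
  fun_prop

/-- Completing the square in `v` exhibits the position marginal times the conditional law of `v`
given `x`, centred at `3x / (2t)`. Its Fourier integral can then be computed in `v` first and in `x`
afterwards. -/
theorem kinKernel_eq {t : ℝ} (ht : 0 < t) (x v : EuclideanSpace ℝ (Fin d)) :
    kinKernel t (mkPhase x v) = (4 * Real.pi ^ 2 * t ^ 4 / 3) ^ (-(d : ℝ) / 2) *
      (Real.exp (-(3 / (4 * t ^ 3)) * ‖x‖ ^ 2) *
        Real.exp (-t⁻¹ * ‖v - (3 / (2 * t)) • x‖ ^ 2)) := by
  unfold kinKernel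
  rw [← Real.exp_add]
  congr 2
  have h : (3 : ℝ) • x - (2 * t) • v = -(2 * t) • (v - (3 / (2 * t)) • x) := by
    rw [smul_sub, smul_smul, show -(2 * t) * (3 / (2 * t)) = -3 by field_simp, neg_smul, neg_smul]
    abel
  simp only [WithLp.toLp_fst, WithLp.toLp_snd]
  rw [h, norm_smul, mul_pow, Real.norm_eq_abs, sq_abs]
  field_simp
  ring

theorem kinKernel_le {t : ℝ} (ht : 0 < t) : ∃ c C : ℝ, 0 < c ∧ ∀ z : Phase d,
    ‖(kinKernel t z : ℂ)‖ ≤ C * Real.exp (-c * ‖z‖ ^ 2) := by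
  have hpi := Real.pi_pos
  set A := (4 * Real.pi ^ 2 * t ^ 4 / 3) ^ (-(d : ℝ) / 2) with hA
  have hA0 : 0 ≤ A := by positivity
  set c := min (1 / (4 * t ^ 3)) (1 / (12 * t)) with hc
  have hc0 : 0 < c := by rw [hc]; positivity
  refine ⟨c, A, hc0, fun z => ?_⟩
  rw [Complex.norm_real, Real.norm_of_nonneg (by unfold kinKernel; positivity)]
  unfold kinKernel
  rw [← hA]
  gcongr
  have h1 : c * (4 * t ^ 3) ≤ 1 := by
    rw [← le_div_iff₀ (by positivity)]; exact min_le_left _ _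
  have h2 : c * (12 * t) ≤ 1 := by
    rw [← le_div_iff₀ (by positivity)]; exact min_le_right _ _
  have hz : ‖z‖ ^ 2 = ‖z.fst‖ ^ 2 + ‖z.snd‖ ^ 2 := WithLp.prod_norm_sq_eq_of_L2 z
  have hw : 2 * t * ‖z.snd‖ ≤ ‖(3 : ℝ) • z.fst - (2 * t) • z.snd‖ + 3 * ‖z.fst‖ := by
    have h3 := norm_sub_le ((3 : ℝ) • z.fst) ((3 : ℝ) • z.fst - (2 * t) • z.snd)
    rw [sub_sub_cancel, norm_smul, norm_smul, Real.norm_of_nonneg (by positivity),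
      Real.norm_of_nonneg (by norm_num)] at h3
    linarith
  set w := ‖(3 : ℝ) • z.fst - (2 * t) • z.snd‖
  set x := ‖z.fst‖
  set v := ‖z.snd‖
  rw [div_le_iff₀ (by positivity), hz]
  have h4 : (2 * t * v) ^ 2 ≤ (w + 3 * x) ^ 2 := by gcongr
  have h5 : c * (4 * t ^ 3) * x ^ 2 ≤ 1 * x ^ 2 := by gcongr
  have h6 : c * (12 * t) * (t ^ 2 * v ^ 2) ≤ 1 * (t ^ 2 * v ^ 2) := by gcongr
  nlinarith [sq_nonneg (w - 3 * x), sq_nonneg w, sq_nonneg x]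

/-- The Fourier symbol of the kinetic kernel, in the variable `ζ = (ξ, η) / 2π`. -/
def kinSymbol (t : ℝ) (ζ : Phase d) : ℝ :=
  Real.exp (-(4 * Real.pi ^ 2 * (t ^ 3 / 3 * ‖ζ.fst‖ ^ 2 + t ^ 2 * inner ℝ ζ.fst ζ.snd +
    t * ‖ζ.snd‖ ^ 2)))

theorem integral_phase_prod {u : Phase d → ℂ} (hu : Integrable u) :
    ∫ z, u z = ∫ x, ∫ v, u (mkPhase x v) := by
  have hmp := WithLp.volume_preserving_toLp (U := EuclideanSpace ℝ (Fin d))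
    (V := EuclideanSpace ℝ (Fin d))
  have he : MeasurableEmbedding (@WithLp.toLp 2 (EuclideanSpace ℝ (Fin d) ×
      EuclideanSpace ℝ (Fin d))) := (MeasurableEquiv.toLp 2 _).measurableEmbedding
  rw [← hmp.integral_comp he]
  exact integral_prod _ ((hmp.integrable_comp_emb he).mpr hu)

theorem integral_gaussian_character {b : ℝ} (hb : 0 < b) (w : EuclideanSpace ℝ (Fin d)) :
    ∫ v : EuclideanSpace ℝ (Fin d),
      Complex.exp (((-2 * Real.pi * inner ℝ v w : ℝ) : ℂ) * Complex.I) *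
        (Real.exp (-b * ‖v‖ ^ 2) : ℂ) =
      ((Real.pi / b) ^ ((d : ℝ) / 2) * Real.exp (-(Real.pi ^ 2 * ‖w‖ ^ 2 / b)) : ℝ) := by
  have h := fourier_gaussian_innerProductSpace (V := EuclideanSpace ℝ (Fin d)) (b := (b : ℂ))
    (by simpa using hb) w
  rw [Real.fourier_eq'] at h
  have hpi := Real.pi_pos
  rw [Complex.ofReal_mul, Complex.ofReal_cpow (by positivity)]
  push_cast
  simp only [finrank_euclideanSpace_fin, smul_eq_mul] at h
  push_cast at h
  rw [h]
  congr 2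
  ring

theorem fourier_kinKernel {t : ℝ} (ht : 0 < t) (ζ : Phase d) :
    𝓕 (fun y : Phase d => (kinKernel t y : ℂ)) ζ = kinSymbol t ζ := by
  have hpi := Real.pi_pos
  obtain ⟨c, C, hc, hC⟩ := kinKernel_le (d := d) ht
  have hcont : Continuous fun y : Phase d => (kinKernel t y : ℂ) :=
    Complex.continuous_ofReal.comp (continuous_kinKernel t)
  have hint := integrable_of_gaussian_bound hc hcont hC
  rw [Real.fourier_eq', integral_phase_prod]
  swap
  · have := (Real.fourierIntegral_convergent_iff (μ := volume) ζ).mpr hint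
    refine this.congr (Filter.Eventually.of_forall fun z => ?_)
    simp only [Circle.smul_def, Real.fourierChar_apply]
    congr 3
    push_cast; ring
  set ξ := ζ.fst
  set η := ζ.snd
  set A := (4 * Real.pi ^ 2 * t ^ 4 / 3) ^ (-(d : ℝ) / 2) with hA
  set β := 3 / (2 * t) with hβ
  have hinner : ∀ x : EuclideanSpace ℝ (Fin d),
      ∫ v, Complex.exp (((-2 * Real.pi * inner ℝ (mkPhase x v) ζ : ℝ) : ℂ) * Complex.I) •
        (kinKernel t (mkPhase x v) : ℂ) =
      ((A * ((Real.pi / t⁻¹) ^ ((d : ℝ) / 2) * Real.exp (-(Real.pi ^ 2 * ‖η‖ ^ 2 / t⁻¹))) : ℝ) : ℂ) *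
      (Complex.exp (((-2 * Real.pi * inner ℝ x (ξ + β • η) : ℝ) : ℂ) * Complex.I) *
        (Real.exp (-(3 / (4 * t ^ 3)) * ‖x‖ ^ 2) : ℂ)) := fun x => by
    -- Shifting `v` by `β • x` centres the conditional Gaussian; the shift reappears as a character
    -- in `x`, changing the position frequency from `ξ` to `ξ + β • η`.
    rw [Complex.ofReal_mul, ← integral_gaussian_character (inv_pos.mpr ht) η,
      ← integral_sub_right_eq_self (fun v => Complex.exp (((-2 * Real.pi * inner ℝ v η : ℝ) : ℂ) *
        Complex.I) * (Real.exp (-t⁻¹ * ‖v‖ ^ 2) : ℂ)) (β • x), ← integral_const_mul, ← integral_mul_const]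
    refine integral_congr_ae (Filter.Eventually.of_forall fun v => ?_)
    simp only [kinKernel_eq ht, ← hA, ← hβ, smul_eq_mul]
    have : Complex.exp (((-2 * Real.pi * inner ℝ (mkPhase x v) ζ : ℝ) : ℂ) * Complex.I) =
        Complex.exp (((-2 * Real.pi * inner ℝ (v - β • x) η : ℝ) : ℂ) * Complex.I) *
        Complex.exp (((-2 * Real.pi * inner ℝ x (ξ + β • η) : ℝ) : ℂ) * Complex.I) := by
      rw [← Complex.exp_add, ← add_mul, ← Complex.ofReal_add]
      congr 3
      rw [WithLp.prod_inner_apply, inner_sub_left, inner_add_right, inner_smul_left,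
        inner_smul_right]
      simp only [conj_trivial]
      change -2 * Real.pi * (inner ℝ x ξ + inner ℝ v η) = _
      ring
    rw [this]
    push_cast
    ring
  simp only [hinner]
  rw [integral_const_mul, integral_gaussian_character (by positivity), ← Complex.ofReal_mul]
  congr 1
  rw [kinSymbol]
  have hconst : A * (Real.pi / t⁻¹) ^ ((d : ℝ) / 2) *
      (Real.pi / (3 / (4 * t ^ 3))) ^ ((d : ℝ) / 2) = 1 := by
    rw [mul_assoc, ← Real.mul_rpow (by positivity) (by positivity), hA, neg_div,
      Real.rpow_neg (by positivity)]
    rw [show Real.pi / t⁻¹ * (Real.pi / (3 / (4 * t ^ 3))) = 4 * Real.pi ^ 2 * t ^ 4 / 3 by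
      field_simp]
    exact inv_mul_cancel₀ (by positivity)
  calc _ = (A * (Real.pi / t⁻¹) ^ ((d : ℝ) / 2) *
      (Real.pi / (3 / (4 * t ^ 3))) ^ ((d : ℝ) / 2)) * (Real.exp (-(Real.pi ^ 2 * ‖η‖ ^ 2 / t⁻¹)) *
        Real.exp (-(Real.pi ^ 2 * ‖ξ + β • η‖ ^ 2 / (3 / (4 * t ^ 3))))) := by ring
    _ = _ := by
      rw [hconst, one_mul, ← Real.exp_add]
      congr 1
      rw [norm_add_sq_real, norm_smul, inner_smul_right, mul_pow, Real.norm_eq_abs, sq_abs, hβ]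
      field_simp
      ring

end Kernel

/-! ### The semigroup and the smoothing estimate in Fourier variables -/

section Semigroup

variable {d : ℕ}

/-- The free transport `(x, v) ↦ (x + tv, v)`. -/
def shear (t : ℝ) (z : Phase d) : Phase d := mkPhase (z.fst + t • z.snd) z.snd

/-- The transpose `(ξ, η) ↦ (ξ, η + tξ)` of the free transport. -/
def coshear (t : ℝ) (ζ : Phase d) : Phase d := mkPhase ζ.fst (ζ.snd + t • ζ.fst)

theorem inner_shear (t : ℝ) (z ζ : Phase d) :
    inner ℝ (shear t z) ζ = inner ℝ z (coshear t ζ) := by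
  change inner ℝ (z.fst + t • z.snd) ζ.fst + inner ℝ z.snd ζ.snd =
    inner ℝ z.fst ζ.fst + inner ℝ z.snd (ζ.snd + t • ζ.fst)
  rw [inner_add_left, inner_add_right, inner_smul_left, inner_smul_right]
  simp only [conj_trivial]; ring

theorem continuous_coshear_uncurry : Continuous fun p : ℝ × Phase d => coshear p.1 p.2 := by
  unfold coshear mkPhase
  have h1 := (continuous_phase_fst (d := d)).comp continuous_snd (X := ℝ × Phase d)
  have h2 := (continuous_phase_snd (d := d)).comp continuous_snd (X := ℝ × Phase d)
  exact (WithLp.prod_continuous_toLp ..).comp (h1.prodMk (h2.add (continuous_fst.smul h1)))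

theorem continuous_coshear (t : ℝ) : Continuous (coshear t : Phase d → Phase d) :=
  continuous_coshear_uncurry.comp (Continuous.prodMk_right t)

theorem coshear_coshear_neg (t : ℝ) (ζ : Phase d) : coshear t (coshear (-t) ζ) = ζ := by
  have h : ζ.snd + (-t) • ζ.fst + t • ζ.fst = ζ.snd := by rw [neg_smul]; abel
  exact congrArg (mkPhase ζ.fst) h

/-- For fixed first coordinate the shear is a translation of the second, so Fubini applies. -/
theorem measurePreserving_coshear (t : ℝ) :
    MeasurePreserving (coshear t : Phase d → Phase d) volume volume := by
  have h : MeasurePreserving (fun p : EuclideanSpace ℝ (Fin d) × EuclideanSpace ℝ (Fin d) =>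
      (p.1, p.2 + t • p.1)) volume volume :=
    (MeasurePreserving.id volume).skew_product (g := fun x v => v + t • x) (by fun_prop)
      (Filter.Eventually.of_forall fun x => (measurePreserving_add_right volume (t • x)).map_eq)
  exact (WithLp.volume_preserving_toLp _ _).comp (h.comp (WithLp.volume_preserving_ofLp _ _))

theorem measurableEmbedding_coshear (t : ℝ) :
    MeasurableEmbedding (coshear t : Phase d → Phase d) :=
  (MeasurableEquiv.mk ⟨coshear t, coshear (-t), fun ζ => by
    simpa using coshear_coshear_neg (-t) ζ, coshear_coshear_neg t⟩
    (continuous_coshear t).measurable (continuous_coshear (-t)).measurable).measurableEmbedding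

theorem integral_comp_coshear (t : ℝ) (u : Phase d → ℂ) :
    ∫ ζ, u (coshear t ζ) = ∫ ζ, u ζ :=
  (measurePreserving_coshear t).integral_comp (measurableEmbedding_coshear t) u

/-- The Fourier representation of the kinetic semigroup on `L²`. -/
theorem kinSemigroup_eq {t : ℝ} (ht : 0 < t) (f : L2 d) (z : Phase d) :
    kinSemigroup t f z =
      ∫ ζ, phase (shear t z) ζ * ((kinSymbol t ζ : ℂ) * (𝓕 f : L2 d) ζ) := by
  obtain ⟨c, C, hc, hC⟩ := kinKernel_le (d := d) ht
  have hcont : Continuous fun y : Phase d => (kinKernel t y : ℂ) :=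
    Complex.continuous_ofReal.comp (continuous_kinKernel t)
  have h1 := integrable_of_gaussian_bound hc hcont hC
  have h2 := memLp_two_of_gaussian_bound hc hcont hC
  set a := shear t z
  set τ := Lp.compMeasurePreserving (· + a) (measurePreserving_add_right volume a) f
  -- Parseval for the kernel paired with `f` translated by `shear t z`. The kernel and its symbol
  -- are real, so the conjugation in the inner product is harmless.
  have hP := Lp.inner_fourier_eq (h2.toLp _) τ
  rw [L2.inner_def, L2.inner_def] at hP
  rw [kinSemigroup, if_neg ht.ne']
  calc _ = ∫ y, inner ℂ (h2.toLp _ y) (τ y) := by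
        refine integral_congr_ae ?_
        filter_upwards [h2.coeFn_toLp, Lp.coeFn_compMeasurePreserving f
          (measurePreserving_add_right volume a)] with y hy1 hy2
        rw [hy1, hy2]
        simp only [RCLike.inner_apply, Complex.conj_ofReal]
        rw [mul_comm]
        congr 2
        exact (add_comm a y :)
    _ = _ := hP.symm
    _ = _ := by
        refine integral_congr_ae ?_
        filter_upwards [fourier_toLp_ae_eq h1 h2, fourier_translate f a] with ζ h3 h4
        rw [h3, h4, fourier_kinKernel ht]
        simp only [RCLike.inner_apply, Complex.conj_ofReal]
        ring

/-- The parabolic size `t³|ξ|² + t|η|²` that controls the kinetic symbol. -/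
def parSize (t : ℝ) (ζ : Phase d) : ℝ :=
  t ^ 3 * ‖((2 * Real.pi) • ζ).fst‖ ^ 2 + t * ‖((2 * Real.pi) • ζ).snd‖ ^ 2

theorem parSize_nonneg {t : ℝ} (ht : 0 < t) (ζ : Phase d) : 0 ≤ parSize t ζ := by
  unfold parSize; positivity

theorem kinSymbol_pos (t : ℝ) (ζ : Phase d) : 0 < kinSymbol t ζ := Real.exp_pos _

theorem norm_sq_fst_two_pi (ζ : Phase d) :
    ‖((2 * Real.pi) • ζ).fst‖ ^ 2 = 4 * Real.pi ^ 2 * ‖ζ.fst‖ ^ 2 := by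
  rw [WithLp.smul_fst, norm_smul, mul_pow, Real.norm_eq_abs, sq_abs]; ring

theorem norm_sq_snd_two_pi (ζ : Phase d) :
    ‖((2 * Real.pi) • ζ).snd‖ ^ 2 = 4 * Real.pi ^ 2 * ‖ζ.snd‖ ^ 2 := by
  rw [WithLp.smul_snd, norm_smul, mul_pow, Real.norm_eq_abs, sq_abs]; ring

/-- The quadratic form in the exponent is `∫₀ᵗ |η + rξ|² dr`. After the rescaling by powers of `t`
it is uniformly positive definite, with room to spare for the constant `1/16`. -/
theorem kinSymbol_le {t : ℝ} (ht : 0 < t) (ζ : Phase d) :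
    kinSymbol t ζ ≤ Real.exp (-(parSize t ζ / 16)) := by
  unfold kinSymbol parSize
  rw [norm_sq_fst_two_pi, norm_sq_snd_two_pi]
  refine Real.exp_le_exp.mpr (neg_le_neg ?_)
  have h := abs_real_inner_le_norm ζ.fst ζ.snd
  have h' := neg_le_of_abs_le h
  set x := ‖ζ.fst‖
  set v := ‖ζ.snd‖
  have h1 : t ^ 2 * inner ℝ ζ.fst ζ.snd ≥ -(t ^ 2 * (x * v)) := by
    have := mul_le_mul_of_nonneg_left h' (sq_nonneg t)
    linarith
  have h2 : (t ^ 3 * x ^ 2 + t * v ^ 2) / 16 ≤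
      t ^ 3 / 3 * x ^ 2 + t ^ 2 * inner ℝ ζ.fst ζ.snd + t * v ^ 2 := by
    have h3 : 0 ≤ t * (13 / 48 * (t * x) ^ 2 - (t * x) * v + 15 / 16 * v ^ 2) := by
      refine mul_nonneg ht.le ?_
      nlinarith [sq_nonneg (t * x - 2 * v), sq_nonneg v, sq_nonneg (t * x - 24 / 13 * v)]
    nlinarith
  have hpi := Real.pi_pos
  calc _ = 4 * Real.pi ^ 2 * ((t ^ 3 * x ^ 2 + t * v ^ 2) / 16) := by ring
    _ ≤ _ := by gcongr

/-- The Fourier multiplier of `∂_{v_i} P_t`, before transport. -/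
def velSymbol (i : Fin d) (t : ℝ) (ζ : Phase d) : ℂ :=
  ((2 * Real.pi * (ζ.snd i + t * ζ.fst i) : ℝ) : ℂ) * Complex.I * (kinSymbol t ζ : ℂ)

theorem continuous_kinSymbol_uncurry : Continuous fun p : ℝ × Phase d => kinSymbol p.1 p.2 := by
  unfold kinSymbol
  have h1 := (continuous_phase_fst (d := d)).comp continuous_snd (X := ℝ × Phase d)
  have h2 := (continuous_phase_snd (d := d)).comp continuous_snd (X := ℝ × Phase d)
  have h3 : Continuous fun p : ℝ × Phase d => (inner ℝ p.2.fst p.2.snd : ℝ) := h1.inner h2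
  have h4 : Continuous fun p : ℝ × Phase d => ‖p.2.fst‖ := h1.norm
  have h5 : Continuous fun p : ℝ × Phase d => ‖p.2.snd‖ := h2.norm
  fun_prop

theorem continuous_velSymbol_uncurry (i : Fin d) :
    Continuous fun p : ℝ × Phase d => velSymbol i p.1 p.2 := by
  unfold velSymbol
  have h1 := (continuous_phase_fst (d := d)).comp continuous_snd (X := ℝ × Phase d)
  have h2 := (continuous_phase_snd (d := d)).comp continuous_snd (X := ℝ × Phase d)
  have h3 : Continuous fun p : ℝ × Phase d => p.2.fst i :=
    (EuclideanSpace.proj (𝕜 := ℝ) i).continuous.comp h1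
  have h4 : Continuous fun p : ℝ × Phase d => p.2.snd i :=
    (EuclideanSpace.proj (𝕜 := ℝ) i).continuous.comp h2
  have h5 := continuous_kinSymbol_uncurry (d := d)
  exact ((Complex.continuous_ofReal.comp (by fun_prop)).mul continuous_const).mul
    (Complex.continuous_ofReal.comp h5)

theorem continuous_velSymbol (i : Fin d) (t : ℝ) : Continuous (velSymbol i t) :=
  (continuous_velSymbol_uncurry i).comp (Continuous.prodMk_right t)

theorem continuous_kinSymbol (t : ℝ) : Continuous (kinSymbol t : Phase d → ℝ) :=
  Continuous.comp (g := fun p : ℝ × Phase d => kinSymbol p.1 p.2) (f := fun ζ => (t, ζ))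
    continuous_kinSymbol_uncurry (Continuous.prodMk_right t)

theorem norm_velSymbol_sq_le {t : ℝ} (ht : 0 < t) (i : Fin d) (ζ : Phase d) :
    ‖velSymbol i t ζ‖ ^ 2 ≤ 2 / t * parSize t ζ * Real.exp (-(parSize t ζ / 8)) := by
  have hpi := Real.pi_pos
  have h1 := kinSymbol_le ht ζ
  have h0 := kinSymbol_pos t ζ
  have h2 : kinSymbol t ζ ^ 2 ≤ Real.exp (-(parSize t ζ / 8)) := by
    calc _ ≤ Real.exp (-(parSize t ζ / 16)) ^ 2 := by gcongr
      _ = _ := by rw [← Real.exp_nat_mul]; congr 1; push_cast; ring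
  have hx : |ζ.fst i| ≤ ‖ζ.fst‖ := PiLp.norm_apply_le ζ.fst i
  have hv : |ζ.snd i| ≤ ‖ζ.snd‖ := PiLp.norm_apply_le ζ.snd i
  have hx2 : (ζ.fst i) ^ 2 ≤ ‖ζ.fst‖ ^ 2 := by rw [← sq_abs]; gcongr
  have hv2 : (ζ.snd i) ^ 2 ≤ ‖ζ.snd‖ ^ 2 := by rw [← sq_abs]; gcongr
  have h3 : (2 * Real.pi * (ζ.snd i + t * ζ.fst i)) ^ 2 ≤ 2 / t * parSize t ζ := by
    unfold parSize
    rw [norm_sq_fst_two_pi, norm_sq_snd_two_pi]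
    have : 2 / t * (t ^ 3 * (4 * Real.pi ^ 2 * ‖ζ.fst‖ ^ 2) + t * (4 * Real.pi ^ 2 * ‖ζ.snd‖ ^ 2)) =
      4 * Real.pi ^ 2 * (2 * (t ^ 2 * ‖ζ.fst‖ ^ 2 + ‖ζ.snd‖ ^ 2)) := by field_simp
    rw [this, mul_pow, mul_pow]
    have h4 : t ^ 2 * (ζ.fst i) ^ 2 ≤ t ^ 2 * ‖ζ.fst‖ ^ 2 := by gcongr
    have h5 : (ζ.snd i + t * ζ.fst i) ^ 2 ≤ 2 * (t ^ 2 * ‖ζ.fst‖ ^ 2 + ‖ζ.snd‖ ^ 2) := by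
      nlinarith [sq_nonneg (ζ.snd i - t * ζ.fst i)]
    calc _ = 4 * Real.pi ^ 2 * (ζ.snd i + t * ζ.fst i) ^ 2 := by ring
      _ ≤ _ := by gcongr
  unfold velSymbol
  rw [norm_mul, norm_mul, Complex.norm_I, mul_one, Complex.norm_real, Complex.norm_real, mul_pow,
    Real.norm_eq_abs, sq_abs, Real.norm_eq_abs, sq_abs]
  have := parSize_nonneg ht ζ
  gcongr

/-- A single term of the exponential series at `(1 + U) / 8`, of degree at least `p`, dominates the
power. -/
theorem exists_one_add_rpow_mul_exp_le (p : ℝ) :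
    ∃ C : ℝ, 0 < C ∧ ∀ U : ℝ, 0 ≤ U → (1 + U) ^ p * Real.exp (-(U / 8)) ≤ C := by
  obtain ⟨n, hn⟩ := exists_nat_ge p
  refine ⟨n.factorial * 8 ^ n * Real.exp (1 / 8), by positivity, fun U hU => ?_⟩
  have h1 := Real.pow_div_factorial_le_exp ((1 + U) / 8) (by positivity) n
  rw [div_le_iff₀ (by positivity), div_pow, div_le_iff₀ (by positivity)] at h1
  have h2 : (1 + U) ^ p ≤ (1 + U) ^ n := by
    rw [← Real.rpow_natCast]
    exact Real.rpow_le_rpow_of_exponent_le (by linarith) hn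
  calc _ ≤ (Real.exp ((1 + U) / 8) * n.factorial * 8 ^ n) * Real.exp (-(U / 8)) := by
        gcongr; exact h2.trans h1
    _ = n.factorial * 8 ^ n * (Real.exp ((1 + U) / 8) * Real.exp (-(U / 8))) := by ring
    _ = _ := by rw [← Real.exp_add]; congr 2; ring

/-- The only dangerous term is `(t|ξ|)²`. With `y = |ξ|^(2/3)` it equals `(ty)² y`, and `(ty)² ≤ 1 +
(ty)³ = 1 + t³|ξ|²`: the kinetic exponent `2/3` is the one for which the shear costs only a factor
of order `1 + U`. -/
theorem kinWeight_coshear_le {t : ℝ} (ht : 0 < t) (ζ : Phase d) :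
    kinWeight ((2 * Real.pi) • coshear t ζ) ≤
      3 * (1 + parSize t ζ) * kinWeight ((2 * Real.pi) • ζ) := by
  have he : (2 * Real.pi) • coshear t ζ = coshear t ((2 * Real.pi) • ζ) := by
    have : (2 * Real.pi) • (ζ.snd + t • ζ.fst) =
        (2 * Real.pi) • ζ.snd + t • ((2 * Real.pi) • ζ.fst) := by
      rw [smul_add, smul_comm]
    exact congrArg (mkPhase ((2 * Real.pi) • ζ.fst)) this
  rw [he]
  unfold parSize
  set ω := (2 * Real.pi) • ζ
  unfold kinWeight
  change 1 + ‖ω.fst‖ ^ (2 / 3 : ℝ) + ‖ω.snd + t • ω.fst‖ ^ 2 ≤ _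
  set x := ‖ω.fst‖ with hx
  set v := ‖ω.snd‖
  have hx0 : 0 ≤ x := norm_nonneg _
  have hv0 : 0 ≤ v := norm_nonneg _
  set U := t ^ 3 * x ^ 2 + t * v ^ 2 with hU
  have h1 : ‖ω.snd + t • ω.fst‖ ≤ v + t * x := by
    refine (norm_add_le _ _).trans ?_
    rw [norm_smul, Real.norm_of_nonneg ht.le]
  have h2 : ‖ω.snd + t • ω.fst‖ ^ 2 ≤ 2 * v ^ 2 + 2 * (t * x) ^ 2 := by
    calc _ ≤ (v + t * x) ^ 2 := by gcongr
      _ ≤ _ := by nlinarith [sq_nonneg (v - t * x)]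
  set y := x ^ (2 / 3 : ℝ) with hy
  have hy0 : 0 ≤ y := by positivity
  have hxy : x ^ 2 = y ^ 3 := by
    rw [hy, ← Real.rpow_natCast, ← Real.rpow_natCast, ← Real.rpow_mul hx0]; norm_num
  have h3 : (t * x) ^ 2 ≤ (1 + U) * y := by
    have h4 : (t * x) ^ 2 = (t * y) ^ 2 * y := by rw [mul_pow, hxy]; ring
    rw [h4]
    gcongr
    have h5 : (t * y) ^ 3 ≤ U := by
      rw [mul_pow, ← hxy, hU]
      have : 0 ≤ t * v ^ 2 := by positivity
      linarith
    have h6 : 0 ≤ t * y := by positivity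
    nlinarith [mul_nonneg h6 (sq_nonneg (t * y - 1)), sq_nonneg (t * y - 1), pow_nonneg h6 3]
  have hU0 : 0 ≤ U := by positivity
  nlinarith [mul_nonneg hU0 hy0, mul_nonneg hU0 (sq_nonneg v), sq_nonneg v]

/-- The smoothing estimate for `∂_{v_i} P_t` on the Fourier side. -/
theorem exists_kinWeight_mul_velSymbol_le (d : ℕ) {s : ℝ} (hs : 0 < s) :
    ∃ C : ℝ, 0 < C ∧ ∀ (i : Fin d) (t : ℝ), 0 < t → ∀ ζ : Phase d,
      kinWeight ((2 * Real.pi) • coshear t ζ) ^ s * ‖velSymbol i t ζ‖ ^ 2 ≤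
        C / t * kinWeight ((2 * Real.pi) • ζ) ^ s := by
  obtain ⟨C, hC, h⟩ := exists_one_add_rpow_mul_exp_le (s + 1)
  refine ⟨3 ^ s * 2 * C, by positivity, fun i t ht ζ => ?_⟩
  have hW : 0 ≤ kinWeight ((2 * Real.pi) • ζ) := zero_le_one.trans (one_le_kinWeight _)
  have hW' : 0 ≤ kinWeight ((2 * Real.pi) • coshear t ζ) :=
    zero_le_one.trans (one_le_kinWeight _)
  have hU := parSize_nonneg ht ζ
  have h1 := Real.rpow_le_rpow hW' (kinWeight_coshear_le ht ζ) hs.le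
  rw [Real.mul_rpow (by positivity) hW, Real.mul_rpow (by positivity) (by positivity)] at h1
  have h2 := norm_velSymbol_sq_le ht i ζ
  have h3 := h _ hU
  set U := parSize t ζ
  set W := kinWeight ((2 * Real.pi) • ζ)
  calc _ ≤ (3 ^ s * (1 + U) ^ s * W ^ s) * (2 / t * U * Real.exp (-(U / 8))) := by gcongr
    _ ≤ (3 ^ s * (1 + U) ^ s * W ^ s) * (2 / t * (1 + U) * Real.exp (-(U / 8))) := by
      gcongr; linarith
    _ = 3 ^ s * 2 / t * W ^ s * ((1 + U) ^ (s + 1) * Real.exp (-(U / 8))) := by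
      rw [Real.rpow_add_one (by positivity)]; ring
    _ ≤ 3 ^ s * 2 / t * W ^ s * C := by gcongr
    _ = _ := by ring

theorem exists_mul_norm_sq_le_parSize {t : ℝ} (ht : 0 < t) :
    ∃ c : ℝ, 0 < c ∧ ∀ ζ : Phase d, c * ‖ζ‖ ^ 2 ≤ parSize t ζ := by
  have hpi := Real.pi_pos
  refine ⟨4 * Real.pi ^ 2 * min (t ^ 3) t, by positivity, fun ζ => ?_⟩
  unfold parSize
  rw [norm_sq_fst_two_pi, norm_sq_snd_two_pi, WithLp.prod_norm_sq_eq_of_L2]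
  calc _ = 4 * Real.pi ^ 2 * (min (t ^ 3) t * ‖ζ.fst‖ ^ 2 + min (t ^ 3) t * ‖ζ.snd‖ ^ 2) := by ring
    _ ≤ 4 * Real.pi ^ 2 * (t ^ 3 * ‖ζ.fst‖ ^ 2 + t * ‖ζ.snd‖ ^ 2) := by
      gcongr
      · exact min_le_left _ _
      · exact min_le_right _ _
    _ = _ := by ring

theorem kinSymbol_gaussian_bound {t : ℝ} (ht : 0 < t) : ∃ c C : ℝ, 0 < c ∧ ∀ ζ : Phase d,
    ‖(kinSymbol t ζ : ℂ)‖ ≤ C * Real.exp (-c * ‖ζ‖ ^ 2) := by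
  obtain ⟨c, hc, h⟩ := exists_mul_norm_sq_le_parSize (d := d) ht
  refine ⟨c / 16, 1, by positivity, fun ζ => ?_⟩
  rw [Complex.norm_real, Real.norm_of_nonneg (kinSymbol_pos t ζ).le, one_mul]
  refine (kinSymbol_le ht ζ).trans (Real.exp_le_exp.mpr ?_)
  linarith [h ζ]

theorem velSymbol_gaussian_bound {t : ℝ} (ht : 0 < t) (i : Fin d) :
    ∃ c C : ℝ, 0 < c ∧ ∀ ζ : Phase d, ‖velSymbol i t ζ‖ ≤ C * Real.exp (-c * ‖ζ‖ ^ 2) := by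
  obtain ⟨c, hc, h⟩ := exists_mul_norm_sq_le_parSize (d := d) ht
  refine ⟨c / 32, Real.sqrt (2 / t * 16), by positivity, fun ζ => ?_⟩
  have h1 := norm_velSymbol_sq_le ht i ζ
  have hU := parSize_nonneg ht ζ
  refine le_of_sq_le_sq ?_ (by positivity)
  rw [mul_pow, Real.sq_sqrt (by positivity), ← Real.exp_nat_mul]
  refine h1.trans ?_
  -- Half of the decay `exp (-U / 8)` is given up to absorb the polynomial factor `U`.
  have h2 : parSize t ζ ≤ 16 * Real.exp (parSize t ζ / 16) := by
    linarith [Real.add_one_le_exp (parSize t ζ / 16)]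
  calc _ ≤ 2 / t * (16 * Real.exp (parSize t ζ / 16)) * Real.exp (-(parSize t ζ / 8)) := by gcongr
    _ = 2 / t * 16 * Real.exp (-(parSize t ζ / 16)) := by
      rw [mul_assoc, mul_assoc, mul_assoc, ← Real.exp_add]; ring_nf
    _ ≤ _ := by
      gcongr
      push_cast
      linarith [h ζ]

end Semigroup

/-! ### Velocity derivatives of the semigroup on `H^s_k` -/

section VelocityDerivative

variable {d : ℕ}

theorem memLp_two_mul_of_gaussian_bound {c C : ℝ} (hc : 0 < c) {u : Phase d → ℂ}
    (hu : Continuous u) (h : ∀ z, ‖u z‖ ≤ C * Real.exp (-c * ‖z‖ ^ 2)) (f : L2 d) :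
    MemLp (fun ζ => u ζ * f ζ) 2 volume := by
  refine (Lp.memLp f).of_le_mul (c := C) (hu.aestronglyMeasurable.mul (Lp.aestronglyMeasurable _))
    (Filter.Eventually.of_forall fun ζ => ?_)
  rw [norm_mul]
  have hC : 0 ≤ C := nonneg_of_mul_nonneg_left ((norm_nonneg _).trans (h 0)) (Real.exp_pos _)
  gcongr
  refine (h ζ).trans (mul_le_of_le_one_right hC ?_)
  rw [Real.exp_le_one_iff]
  nlinarith [sq_nonneg ‖ζ‖]

theorem integrable_mul_of_gaussian_bound {c C : ℝ} (hc : 0 < c) {u : Phase d → ℂ}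
    (hu : Continuous u) (h : ∀ z, ‖u z‖ ≤ C * Real.exp (-c * ‖z‖ ^ 2)) (f : L2 d) :
    Integrable (fun ζ => u ζ * f ζ) :=
  (memLp_two_of_gaussian_bound hc hu h).integrable_mul (Lp.memLp f)

theorem hasDerivAt_phase (a b ζ : Phase d) (u : ℝ) :
    HasDerivAt (fun u : ℝ => phase (a + u • b) ζ)
      (phase (a + u • b) ζ * (((2 * Real.pi * inner ℝ b ζ : ℝ) : ℂ) * Complex.I)) u := by
  have h1 : HasDerivAt (fun u : ℝ => 2 * Real.pi * inner ℝ (a + u • b) ζ)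
      (2 * Real.pi * inner ℝ b ζ) u := by
    have h2 : (fun u : ℝ => 2 * Real.pi * inner ℝ (a + u • b) ζ) =
        fun u : ℝ => 2 * Real.pi * inner ℝ a ζ + u * (2 * Real.pi * inner ℝ b ζ) := by
      funext u
      rw [inner_add_left, inner_smul_left]
      simp only [conj_trivial]; ring
    rw [h2]
    simpa using ((hasDerivAt_id u).mul_const (2 * Real.pi * inner ℝ b ζ)).const_add
      (2 * Real.pi * inner ℝ a ζ)
  exact (h1.ofReal_comp.mul_const Complex.I).cexp

theorem shear_add_smul (t : ℝ) (i : Fin d) (z : Phase d) (u : ℝ) :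
    shear t (z + u • mkPhase 0 (EuclideanSpace.single i 1)) =
      shear t z + u • mkPhase (t • EuclideanSpace.single i 1) (EuclideanSpace.single i 1) := by
  have h : z.fst + u • (0 : EuclideanSpace ℝ (Fin d)) +
      t • (z.snd + u • EuclideanSpace.single i (1 : ℝ)) =
      z.fst + t • z.snd + u • (t • EuclideanSpace.single i (1 : ℝ)) := by
    rw [smul_zero, add_zero, smul_add, smul_comm t u, add_assoc]
  exact congrArg (fun x => mkPhase x (z.snd + u • EuclideanSpace.single i (1 : ℝ))) h

/-- Differentiation of the Fourier representation of the kinetic semigroup. -/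
theorem velDeriv_kinSemigroup_eq {t : ℝ} (ht : 0 < t) (i : Fin d) (f : L2 d) (z : Phase d) :
    velDeriv i (kinSemigroup t f) z =
      ∫ ζ, phase (shear t z) ζ * (velSymbol i t ζ * (𝓕 f : L2 d) ζ) := by
  obtain ⟨c, C, hc, hC⟩ := kinSymbol_gaussian_bound (d := d) ht
  obtain ⟨c', C', hc', hC'⟩ := velSymbol_gaussian_bound ht i
  have hkc : Continuous fun ζ : Phase d => (kinSymbol t ζ : ℂ) :=
    Complex.continuous_ofReal.comp (continuous_kinSymbol t)
  have hG := integrable_mul_of_gaussian_bound hc hkc hC (𝓕 f : L2 d)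
  have hG' := integrable_mul_of_gaussian_bound hc' (continuous_velSymbol i t) hC' (𝓕 f : L2 d)
  set b : Phase d := mkPhase (t • EuclideanSpace.single i 1) (EuclideanSpace.single i 1) with hb
  have hbi : ∀ ζ : Phase d, inner ℝ b ζ = ζ.snd i + t * ζ.fst i := fun ζ => by
    change inner ℝ (t • EuclideanSpace.single i (1 : ℝ)) ζ.fst +
      inner ℝ (EuclideanSpace.single i (1 : ℝ)) ζ.snd = _
    rw [inner_smul_left, EuclideanSpace.inner_single_left, EuclideanSpace.inner_single_left]
    simp only [conj_trivial, one_mul]; ring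
  have hpc : ∀ a : Phase d, AEStronglyMeasurable (phase a) volume := fun a =>
    (contDiff_phase a).continuous.aestronglyMeasurable
  have hder : ∀ (u : ℝ) (ζ : Phase d), HasDerivAt (fun u : ℝ => phase (shear t z + u • b) ζ *
      ((kinSymbol t ζ : ℂ) * (𝓕 f : L2 d) ζ))
      (phase (shear t z + u • b) ζ * (velSymbol i t ζ * (𝓕 f : L2 d) ζ)) u := fun u ζ => by
    have := (hasDerivAt_phase (shear t z) b ζ u).mul_const ((kinSymbol t ζ : ℂ) * (𝓕 f : L2 d) ζ)
    refine this.congr_deriv ?_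
    rw [hbi, velSymbol]; ring
  -- Characters have modulus one, so the integrand of the derivative has modulus independent of `u`
  -- and is its own dominating function.
  have hmain := hasDerivAt_integral_of_dominated_loc_of_deriv_le (μ := (volume : Measure (Phase d)))
    (F := fun (u : ℝ) ζ => phase (shear t z + u • b) ζ * ((kinSymbol t ζ : ℂ) * (𝓕 f : L2 d) ζ))
    (F' := fun (u : ℝ) ζ => phase (shear t z + u • b) ζ * (velSymbol i t ζ * (𝓕 f : L2 d) ζ))
    (x₀ := (0 : ℝ)) (s := univ) (bound := fun ζ => ‖velSymbol i t ζ * (𝓕 f : L2 d) ζ‖)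
    Filter.univ_mem
    (Filter.Eventually.of_forall fun u => (hpc _).mul hG.aestronglyMeasurable)
    (hG.mono ((hpc _).mul hG.aestronglyMeasurable) (Filter.Eventually.of_forall fun ζ => by
      rw [norm_mul, norm_phase, one_mul]))
    ((hpc _).mul hG'.aestronglyMeasurable)
    (Filter.Eventually.of_forall fun ζ u _ => by rw [norm_mul, norm_phase, one_mul])
    hG'.norm
    (Filter.Eventually.of_forall fun ζ u _ => hder u ζ)
  have hfun : (fun u : ℝ => kinSemigroup t f (z + u • mkPhase 0 (EuclideanSpace.single i 1))) =
      fun u : ℝ => ∫ ζ, phase (shear t z + u • b) ζ * ((kinSymbol t ζ : ℂ) * (𝓕 f : L2 d) ζ) := by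
    funext u
    rw [kinSemigroup_eq ht, shear_add_smul]
  rw [velDeriv, lineDeriv, hfun, hmain.2.deriv]
  simp only [zero_smul, add_zero]

/-- `∂_{v_i} P_t f` is an `L²` function and its Fourier transform is the transported symbol. -/
theorem exists_velDeriv_kinSemigroup {t : ℝ} (ht : 0 < t) (i : Fin d) (f : L2 d) :
    ∃ g : L2 d, velDeriv i (kinSemigroup t f) =ᵐ[volume] g ∧
      (𝓕 g : L2 d) =ᵐ[volume] fun ζ => velSymbol i t (coshear (-t) ζ) *
        (𝓕 f : L2 d) (coshear (-t) ζ) := by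
  obtain ⟨c, C, hc, hC⟩ := velSymbol_gaussian_bound ht i
  have h1 := integrable_mul_of_gaussian_bound hc (continuous_velSymbol i t) hC (𝓕 f : L2 d)
  have h2 := memLp_two_mul_of_gaussian_bound hc (continuous_velSymbol i t) hC (𝓕 f : L2 d)
  have hmp := measurePreserving_coshear (d := d) (-t)
  set R : Phase d → ℂ := fun ζ => velSymbol i t (coshear (-t) ζ) *
        (𝓕 f : L2 d) (coshear (-t) ζ) with hR
  have hR1 : Integrable R := hmp.integrable_comp_of_integrable h1
  have hR2 : MemLp R 2 volume := h2.comp_measurePreserving hmp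
  refine ⟨𝓕⁻ (hR2.toLp R), ?_, ?_⟩
  · have : velDeriv i (kinSemigroup t f) = 𝓕⁻ R := by
      funext z
      rw [velDeriv_kinSemigroup_eq ht, Real.fourierInv_eq',
        ← integral_comp_coshear t fun v =>
          Complex.exp (((2 * Real.pi * inner ℝ v z : ℝ) : ℂ) * Complex.I) • R v]
      refine integral_congr_ae (Filter.Eventually.of_forall fun ζ => ?_)
      have h3 : coshear (-t) (coshear t ζ) = ζ := by simpa using coshear_coshear_neg (-t) ζ
      simp only [hR, h3, smul_eq_mul, phase, inner_shear, real_inner_comm z]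
    rw [this]
    exact (fourierInv_toLp_ae_eq hR1 hR2).symm
  · rw [FourierTransform.fourier_fourierInv_eq]
    exact hR2.coeFn_toLp

/-- Undoing the shear by a volume-preserving change of variables moves it onto the weight, where the
pointwise smoothing estimate applies. -/
theorem exists_sobEnergy_velDeriv_le (d : ℕ) {s : ℝ} (hs : 0 < s) :
    ∃ C : ℝ, 0 < C ∧ ∀ (i : Fin d) (t : ℝ), 0 < t → ∀ f g : L2 d,
      velDeriv i (kinSemigroup t f) =ᵐ[volume] g →
      sobEnergy s g ≤ ENNReal.ofReal (C / t) * sobEnergy s f := by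
  obtain ⟨C, hC, h⟩ := exists_kinWeight_mul_velSymbol_le d hs
  refine ⟨C, hC, fun i t ht f g hg => ?_⟩
  obtain ⟨g', hg1, hg2⟩ := exists_velDeriv_kinSemigroup ht i f
  obtain rfl : g = g' := Lp.ext (hg.symm.trans hg1)
  have hmp := measurePreserving_coshear (d := d) (-t)
  calc sobEnergy s g = ∫⁻ ζ, (fun ζ => ENNReal.ofReal
        (kinWeight ((2 * Real.pi) • coshear t ζ) ^ s) * ‖velSymbol i t ζ‖ₑ ^ 2 *
          ‖(𝓕 f : L2 d) ζ‖ₑ ^ 2) (coshear (-t) ζ) := by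
        refine lintegral_congr_ae ?_
        filter_upwards [hg2] with ζ hζ
        simp only [hζ, coshear_coshear_neg, enorm_mul, mul_pow, mul_assoc]
    _ = ∫⁻ ζ, ENNReal.ofReal
        (kinWeight ((2 * Real.pi) • coshear t ζ) ^ s) * ‖velSymbol i t ζ‖ₑ ^ 2 *
          ‖(𝓕 f : L2 d) ζ‖ₑ ^ 2 :=
        hmp.lintegral_comp_emb (measurableEmbedding_coshear (-t)) fun ζ => ENNReal.ofReal
          (kinWeight ((2 * Real.pi) • coshear t ζ) ^ s) * ‖velSymbol i t ζ‖ₑ ^ 2 *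
            ‖(𝓕 f : L2 d) ζ‖ₑ ^ 2
    _ ≤ ∫⁻ ζ, ENNReal.ofReal (C / t) * (ENNReal.ofReal (kinWeight ((2 * Real.pi) • ζ) ^ s) *
          ‖(𝓕 f : L2 d) ζ‖ₑ ^ 2) := by
        refine lintegral_mono fun ζ => ?_
        have hW := zero_le_one.trans (one_le_kinWeight ((2 * Real.pi) • coshear t ζ))
        rw [← mul_assoc, ← ENNReal.ofReal_mul (by positivity), ← ofReal_norm (velSymbol i t ζ),
          ← ENNReal.ofReal_pow (norm_nonneg _), ← ENNReal.ofReal_mul (by positivity)]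
        exact mul_le_mul_left (ENNReal.ofReal_le_ofReal (h i t ht ζ)) _
    _ = _ := by rw [lintegral_const_mul' _ _ ENNReal.ofReal_ne_top, sobEnergy]

theorem memHSob_of_ae_eq {s : ℝ} {u : Phase d → ℂ} {F : L2 d} (hu : u =ᵐ[volume] F)
    (hF : F ∈ sobSubmodule d s) : MemHSob s u := by
  refine ⟨(memLp_congr_ae hu).mpr (Lp.memLp F), ?_⟩
  have : MemLp.toLp u ((memLp_congr_ae hu).mpr (Lp.memLp F)) = F :=
    Lp.ext ((MemLp.coeFn_toLp _).trans hu)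
  rwa [this]

theorem HSob.ofFun_toL2_ae {s : ℝ} {u : Phase d → ℂ} (hu : MemHSob s u) :
    ((HSob.ofFun s u).toL2 : Phase d → ℂ) =ᵐ[volume] u := by
  rw [HSob.ofFun, dif_pos hu]
  exact MemLp.coeFn_toLp hu.choose

theorem HSob.ext_ae {s : ℝ} {f g : HSob d s}
    (h : (f.toL2 : Phase d → ℂ) =ᵐ[volume] g.toL2) : f = g :=
  Subtype.ext (Lp.ext h)

theorem memHSob_velDeriv {s : ℝ} (hs : 0 < s) (i : Fin d) {t : ℝ} (ht : 0 < t) (f : HSob d s) :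
    MemHSob s (velDeriv i (kinSemigroup t f.toL2)) := by
  obtain ⟨C, -, h⟩ := exists_sobEnergy_velDeriv_le d hs
  obtain ⟨g, hg, -⟩ := exists_velDeriv_kinSemigroup ht i f.toL2
  refine memHSob_of_ae_eq hg (mem_sobSubmodule_iff.mpr ?_)
  exact (h i t ht _ g hg).trans_lt
    (ENNReal.mul_lt_top ENNReal.ofReal_lt_top (mem_sobSubmodule_iff.mp f.2))

/-- `∂_{v_i} P_t f` as an element of `H^s_k`. -/
def velGrad {s : ℝ} (i : Fin d) (t : ℝ) (f : HSob d s) : HSob d s :=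
  HSob.ofFun s (velDeriv i (kinSemigroup t f.toL2))

theorem exists_norm_velGrad_le (d : ℕ) {s : ℝ} (hs : 0 < s) :
    ∃ C : ℝ, 0 < C ∧ ∀ (i : Fin d) (t : ℝ), 0 < t → ∀ f : HSob d s,
      ‖velGrad i t f‖ ≤ C * t ^ (-(1 / 2) : ℝ) * ‖f‖ := by
  obtain ⟨C, hC, h⟩ := exists_sobEnergy_velDeriv_le d hs
  refine ⟨Real.sqrt C, by positivity, fun i t ht f => ?_⟩
  have h1 := h i t ht f.toL2 (velGrad i t f).toL2
    (HSob.ofFun_toL2_ae (memHSob_velDeriv hs i ht f)).symm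
  have h2 : ‖velGrad i t f‖ₑ ^ 2 ≤ ENNReal.ofReal (C / t) * ‖f‖ₑ ^ 2 := by
    rw [HSob.enorm_sq, HSob.enorm_sq, ← mul_assoc, mul_comm (ENNReal.ofReal (C / t)), mul_assoc]
    gcongr
  rw [← ofReal_norm, ← ofReal_norm, ← ENNReal.ofReal_pow (norm_nonneg _),
    ← ENNReal.ofReal_pow (norm_nonneg _), ← ENNReal.ofReal_mul (by positivity),
    ENNReal.ofReal_le_ofReal_iff (by positivity)] at h2
  refine le_of_sq_le_sq (h2.trans_eq ?_) (by positivity)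
  rw [mul_pow, mul_pow, Real.sq_sqrt hC.le, ← Real.rpow_natCast (t ^ _), ← Real.rpow_mul ht.le,
    div_eq_mul_inv]
  norm_num
  left; left
  exact (Real.rpow_neg_one t).symm

end VelocityDerivative

/-! ### Continuity in time of the velocity derivative -/

section Continuity

open Filter Topology

variable {d : ℕ}

theorem HSob.isometry_toWeighted (d : ℕ) (s : ℝ) : Isometry (HSob.toWeighted d s) :=
  AddMonoidHomClass.isometry_of_norm _ fun _ => rfl

theorem HSob.toWeighted_ae {s : ℝ} (f : HSob d s) :
    (HSob.toWeighted d s f : Phase d → ℂ) =ᵐ[volume] weightedFourier s f.toL2 :=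
  MemLp.coeFn_toLp f.2

/-- The weighted Fourier transform of `∂_{v_i} P_t f`, before transport. -/
def weightedVel (s : ℝ) (i : Fin d) (f : L2 d) (t : ℝ) (ζ : Phase d) : ℂ :=
  sobWeight s (coshear t ζ) • (velSymbol i t ζ * (𝓕 f : L2 d) ζ)

theorem exists_enorm_weightedVel_le (d : ℕ) {s : ℝ} (hs : 0 < s) :
    ∃ C : ℝ, 0 < C ∧ ∀ (i : Fin d) (f : L2 d) (t : ℝ), 0 < t → ∀ ζ : Phase d,
      ‖weightedVel s i f t ζ‖ₑ ^ 2 ≤ ENNReal.ofReal (C / t) *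
        (ENNReal.ofReal (kinWeight ((2 * Real.pi) • ζ) ^ s) * ‖(𝓕 f : L2 d) ζ‖ₑ ^ 2) := by
  obtain ⟨C, hC, h⟩ := exists_kinWeight_mul_velSymbol_le d hs
  have hpi := Real.pi_pos
  refine ⟨((2 * Real.pi) ^ d) ^ 2 * C, by positivity, fun i f t ht ζ => ?_⟩
  have hW := zero_le_one.trans (one_le_kinWeight ((2 * Real.pi) • coshear t ζ))
  have hW' := zero_le_one.trans (one_le_kinWeight ((2 * Real.pi) • ζ))
  rw [weightedVel, enorm_smul, enorm_mul, mul_pow, mul_pow, ← mul_assoc, ← mul_assoc,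
    ← ENNReal.ofReal_mul (by positivity), ← ofReal_norm (velSymbol i t ζ), ← ofReal_norm
    (sobWeight s _), ← ENNReal.ofReal_pow (norm_nonneg _), ← ENNReal.ofReal_pow (norm_nonneg _),
    ← ENNReal.ofReal_mul (by positivity)]
  refine mul_le_mul_left (ENNReal.ofReal_le_ofReal ?_) _
  rw [Real.norm_of_nonneg (sobWeight_pos _ _).le, sobWeight, mul_pow,
    ← Real.rpow_natCast (_ ^ (s / 2)), ← Real.rpow_mul hW, Nat.cast_ofNat, div_mul_cancel₀ _ two_ne_zero]
  calc _ = ((2 * Real.pi) ^ d) ^ 2 *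
        (kinWeight ((2 * Real.pi) • coshear t ζ) ^ s * ‖velSymbol i t ζ‖ ^ 2) := by ring
    _ ≤ ((2 * Real.pi) ^ d) ^ 2 * (C / t * kinWeight ((2 * Real.pi) • ζ) ^ s) := by
      exact mul_le_mul_of_nonneg_left (h i t ht ζ) (by positivity)
    _ = _ := by ring

theorem stronglyMeasurable_weightedVel (s : ℝ) (i : Fin d) (f : L2 d) (t : ℝ) :
    StronglyMeasurable (weightedVel s i f t) :=
  ((continuous_sobWeight s).comp (continuous_coshear t)).stronglyMeasurable.smul
    ((continuous_velSymbol i t).stronglyMeasurable.mul (Lp.stronglyMeasurable _))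

theorem memLp_weightedVel {s : ℝ} (hs : 0 < s) (i : Fin d) (f : HSob d s) {t : ℝ} (ht : 0 < t) :
    MemLp (weightedVel s i f.toL2 t) 2 volume := by
  obtain ⟨C, -, h⟩ := exists_enorm_weightedVel_le d hs
  refine ⟨(stronglyMeasurable_weightedVel s i f.toL2 t).aestronglyMeasurable, ?_⟩
  have h1 : eLpNorm (weightedVel s i f.toL2 t) 2 volume ^ 2 < ⊤ := by
    rw [← lintegral_enorm_sq_eq]
    refine (lintegral_mono (h i f.toL2 t ht)).trans_lt ?_
    rw [lintegral_const_mul' _ _ ENNReal.ofReal_ne_top]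
    exact ENNReal.mul_lt_top ENNReal.ofReal_lt_top (mem_sobSubmodule_iff.mp f.2)
  simpa [ENNReal.pow_lt_top_iff] using h1

/-- Separates the two dependences on `t`. The multiplier is continuous in `t` at each fixed
frequency, while the shear acts on a mere `L²` class and must be treated through continuity of
composition in `L²`. -/
theorem toWeighted_velGrad {s : ℝ} (hs : 0 < s) (i : Fin d) (f : HSob d s) {t : ℝ} (ht : 0 < t) :
    HSob.toWeighted d s (velGrad i t f) =
      Lp.compMeasurePreserving (coshear (-t)) (measurePreserving_coshear (-t))
        ((memLp_weightedVel hs i f ht).toLp _) := by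
  obtain ⟨g, hg1, hg2⟩ := exists_velDeriv_kinSemigroup ht i f.toL2
  have h1 : (velGrad i t f).toL2 = g :=
    Lp.ext ((HSob.ofFun_toL2_ae (memHSob_velDeriv hs i ht f)).trans hg1)
  have hmp := measurePreserving_coshear (d := d) (-t)
  refine Lp.ext ?_
  have h2 := hmp.quasiMeasurePreserving.ae_eq_comp (memLp_weightedVel hs i f ht).coeFn_toLp
  filter_upwards [HSob.toWeighted_ae (velGrad i t f), hg2,
    Lp.coeFn_compMeasurePreserving ((memLp_weightedVel hs i f ht).toLp _) hmp, h2]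
    with ζ h3 h4 h5 h6
  rw [h3, h5, h6, weightedFourier, h1, h4]
  simp only [weightedVel, Function.comp_apply, coshear_coshear_neg]

set_option maxHeartbeats 800000 in
theorem continuous_toLp_weightedVel {s : ℝ} (hs : 0 < s) (i : Fin d) (f : HSob d s) :
    Continuous fun t : Ioi (0 : ℝ) => (memLp_weightedVel hs i f t.2).toLp _ := by
  obtain ⟨C, hC, h⟩ := exists_enorm_weightedVel_le d hs
  rw [continuous_iff_continuousAt]
  intro t₀
  have ht₀ : (0 : ℝ) < t₀ := t₀.2
  rw [ContinuousAt, Lp.tendsto_Lp_iff_tendsto_eLpNorm'']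
  have hnear : ∀ᶠ t : Ioi (0 : ℝ) in 𝓝 t₀, (t₀ : ℝ) / 2 < t :=
    continuous_subtype_val.continuousAt.eventually_const_lt (by linarith)
  set w : Phase d → ℝ≥0∞ := fun ζ =>
    ENNReal.ofReal (kinWeight ((2 * Real.pi) • ζ) ^ s) * ‖(𝓕 f.toL2 : L2 d) ζ‖ₑ ^ 2
  have hsq : Tendsto (fun t : Ioi (0 : ℝ) => ∫⁻ ζ, ‖(weightedVel s i f.toL2 t -
      weightedVel s i f.toL2 t₀) ζ‖ₑ ^ 2) (𝓝 t₀) (𝓝 (∫⁻ _ : Phase d, 0)) := by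
    refine tendsto_lintegral_filter_of_dominated_convergence
      (fun ζ => 2 * (2 * ENNReal.ofReal (C / (t₀ / 2)) * w ζ)) ?_ ?_ ?_ ?_
    · refine Eventually.of_forall fun t => ?_
      exact ((stronglyMeasurable_weightedVel s i f.toL2 t).sub
        (stronglyMeasurable_weightedVel s i f.toL2 t₀)).measurable.enorm.pow_const 2
    · filter_upwards [hnear] with t ht
      refine Eventually.of_forall fun ζ => ?_
      have h1 : ‖weightedVel s i f.toL2 t ζ‖ₑ ^ 2 ≤ ENNReal.ofReal (C / (t₀ / 2)) * w ζ := by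
        refine (h i f.toL2 t t.2 ζ).trans ?_
        gcongr
      have h2 : ‖weightedVel s i f.toL2 t₀ ζ‖ₑ ^ 2 ≤ ENNReal.ofReal (C / (t₀ / 2)) * w ζ := by
        refine (h i f.toL2 t₀ ht₀ ζ).trans ?_
        gcongr
        linarith
      calc _ ≤ (‖weightedVel s i f.toL2 t ζ‖ₑ + ‖weightedVel s i f.toL2 t₀ ζ‖ₑ) ^ 2 := by
            gcongr; exact enorm_sub_le
        _ ≤ 2 * (‖weightedVel s i f.toL2 t ζ‖ₑ ^ 2 + ‖weightedVel s i f.toL2 t₀ ζ‖ₑ ^ 2) :=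
            add_sq_le_two_mul _ _
        _ ≤ 2 * (ENNReal.ofReal (C / (t₀ / 2)) * w ζ + ENNReal.ofReal (C / (t₀ / 2)) * w ζ) := by
            gcongr
        _ = _ := by ring
    · have hw : ∫⁻ ζ, w ζ < ⊤ := mem_sobSubmodule_iff.mp f.2
      simp only [← mul_assoc]
      rw [lintegral_const_mul' _ _ (by finiteness)]
      finiteness
    · refine Eventually.of_forall fun ζ => ?_
      have h1 : Continuous fun t : ℝ => weightedVel s i f.toL2 t ζ := by
        have h2 : Continuous fun t : ℝ => sobWeight s (coshear t ζ) :=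
          (continuous_sobWeight s).comp
            (continuous_coshear_uncurry.comp (Continuous.prodMk_left ζ))
        have h3 : Continuous fun t : ℝ => velSymbol i t ζ :=
          (continuous_velSymbol_uncurry i).comp (Continuous.prodMk_left ζ)
        exact h2.smul (h3.mul continuous_const)
      have h4 : Tendsto (fun t : Ioi (0 : ℝ) => ‖(weightedVel s i f.toL2 t -
          weightedVel s i f.toL2 t₀) ζ‖ₑ ^ 2) (𝓝 t₀)
          (𝓝 (‖(weightedVel s i f.toL2 t₀ - weightedVel s i f.toL2 t₀) ζ‖ₑ ^ 2)) := by
        have h5 : Continuous fun t : Ioi (0 : ℝ) => ‖(weightedVel s i f.toL2 t -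
          weightedVel s i f.toL2 t₀) ζ‖ₑ ^ 2 :=
          (ENNReal.continuous_pow 2).comp
            ((h1.comp continuous_subtype_val).sub continuous_const).enorm
        exact h5.tendsto t₀
      simpa using h4
  simp only [lintegral_enorm_sq_eq, lintegral_const, zero_mul] at hsq
  have hrt := (ENNReal.continuous_rpow_const (y := (1 / 2 : ℝ))).tendsto 0 |>.comp hsq
  refine (hrt.congr fun t => ?_).trans (by simp)
  rw [Function.comp_apply, ← ENNReal.rpow_natCast, ← ENNReal.rpow_mul]
  norm_num

theorem continuousOn_velGrad {s : ℝ} (hs : 0 < s) (i : Fin d) (f : HSob d s) :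
    ContinuousOn (fun t => velGrad i t f) (Ioi 0) := by
  rw [continuousOn_iff_continuous_domRestrict, (HSob.isometry_toWeighted d s).isEmbedding.continuous_iff]
  have h : (HSob.toWeighted d s ∘ (Ioi (0 : ℝ)).domRestrict fun t => velGrad i t f) =
      fun t : Ioi (0 : ℝ) => Lp.compMeasurePreserving
        (⟨coshear (-(t : ℝ)), continuous_coshear _⟩ : C(Phase d, Phase d))
        (measurePreserving_coshear (-(t : ℝ))) ((memLp_weightedVel hs i f t.2).toLp _) :=
    funext fun t => toWeighted_velGrad hs i f t.2
  rw [h]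
  refine (continuous_toLp_weightedVel hs i f).compMeasurePreservingLp ?_ _ (by norm_num)
  refine ContinuousMap.continuous_of_continuous_uncurry _ ?_
  exact continuous_coshear_uncurry.comp
    ((continuous_subtype_val.comp continuous_fst).neg.prodMk continuous_snd)

end Continuity

/-! ### Multiplication by the generalised convolution -/

section Product

variable {d : ℕ} {s α : ℝ}

theorem kinLength_pos {h : Phase d} (hh : h ≠ 0) : 0 < kinLength h := by
  have h1 : 0 ≤ ‖h.fst‖ ^ (1 / 3 : ℝ) := by positivity
  have h2 : 0 ≤ ‖h.snd‖ := norm_nonneg _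
  by_contra hcon
  have h3 : ‖h.fst‖ ^ (1 / 3 : ℝ) + ‖h.snd‖ ≤ 0 := not_lt.mp hcon
  have h4 : h.snd = 0 := norm_eq_zero.mp (by linarith)
  have h5 : h.fst = 0 := by
    have h6 : ‖h.fst‖ ^ (1 / 3 : ℝ) = 0 := by linarith
    exact norm_eq_zero.mp ((Real.rpow_eq_zero (norm_nonneg _) (by norm_num)).mp h6)
  exact hh ((WithLp.ofLp_injective 2) (Prod.ext h5 h4))

theorem eLpNorm_le_kinHolderNorm {V : Type*} [NormedAddCommGroup V] (α : ℝ) (F : Phase d → V) :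
    eLpNorm F ⊤ volume ≤ kinHolderNorm α F := le_self_add

theorem eLpNorm_diffOp_le_kinHolderNorm {V : Type*} [NormedAddCommGroup V] (α : ℝ)
    (F : Phase d → V) {h : Phase d} (hh : h ≠ 0) :
    eLpNorm ((diffOp h)^[⌊α⌋₊ + 1] F) ⊤ volume ≤
      kinHolderNorm α F * ENNReal.ofReal (kinLength h ^ α) := by
  have h1 : 0 < kinLength h ^ α := Real.rpow_pos_of_pos (kinLength_pos hh) α
  rw [← ENNReal.div_le_iff (ENNReal.ofReal_pos.mpr h1).ne' ENNReal.ofReal_ne_top]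
  refine le_trans ?_ le_add_self
  exact le_iSup₂ (f := fun (h : Phase d) (_ : h ≠ 0) =>
    eLpNorm ((diffOp h)^[⌊α⌋₊ + 1] F) ⊤ volume / ENNReal.ofReal (kinLength h ^ α)) h hh

theorem eLpNorm_top_clm_comp_le {V : Type*} [NormedAddCommGroup V] [NormedSpace ℂ V]
    (μ : StrongDual ℂ V) (F : Phase d → V) :
    eLpNorm (fun z => μ (F z)) ⊤ volume ≤ ‖μ‖ₑ * eLpNorm F ⊤ volume :=
  eLpNorm_le_nnreal_smul_eLpNorm_of_ae_le_mul (c := ‖μ‖₊)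
    (Filter.Eventually.of_forall fun z => μ.le_opNNNorm (F z)) ⊤

theorem diffOp_iterate_clm_comp {V : Type*} [NormedAddCommGroup V] [NormedSpace ℂ V]
    (μ : StrongDual ℂ V) (F : Phase d → V) (h : Phase d) (m : ℕ) :
    ((diffOp h)^[m] fun z => μ (F z)) = fun z => μ ((diffOp h)^[m] F z) := by
  induction m generalizing F with
  | zero => rfl
  | succ m ih =>
    rw [Function.iterate_succ_apply, Function.iterate_succ_apply, ← ih]
    congr 1
    funext z
    simp only [diffOp, map_sub]

theorem HSob.ofFun_eq_of_ae {u : Phase d → ℂ} {F : HSob d s}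
    (h : u =ᵐ[volume] F.toL2) : HSob.ofFun s u = F :=
  HSob.ext_ae ((HSob.ofFun_toL2_ae (memHSob_of_ae_eq h F.2)).trans h)

theorem HSob.toL2_add_ae (f g : HSob d s) :
    ((f + g).toL2 : Phase d → ℂ) =ᵐ[volume] fun z => f.toL2 z + g.toL2 z :=
  Lp.coeFn_add f.toL2 g.toL2

theorem HSob.toL2_smul_ae (c : ℂ) (f : HSob d s) :
    ((c • f).toL2 : Phase d → ℂ) =ᵐ[volume] fun z => c * f.toL2 z :=
  Lp.coeFn_smul c f.toL2

theorem HSob.ofFun_sum {ι : Type*} (S : Finset ι) (u : ι → Phase d → ℂ) (F : ι → HSob d s)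
    (h : ∀ i ∈ S, u i =ᵐ[volume] (F i).toL2) :
    HSob.ofFun s (fun z => ∑ i ∈ S, u i z) = ∑ i ∈ S, F i := by
  refine HSob.ofFun_eq_of_ae ?_
  classical
  induction S using Finset.induction_on with
  | empty =>
    simp only [Finset.sum_empty]
    exact (Lp.coeFn_zero ℂ 2 (volume : Measure (Phase d))).symm
  | insert a S ha ih =>
    have h1 := ih fun i hi => h i (Finset.mem_insert_of_mem hi)
    rw [Finset.sum_insert ha]
    filter_upwards [h1, h a (Finset.mem_insert_self a S), HSob.toL2_add_ae (F a) (∑ i ∈ S, F i)]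
      with z h2 h3 h4
    rw [Finset.sum_insert ha, h4, ← h2, h3]

/-- For `α > s`, multiplication by the generalised convolution `(Γ * μ)_i` is a bounded bilinear
operation `H^s_k × (H^s_k)^* → H^s_k`. -/
theorem exists_mulGenConv (hs : 0 < s) (hα : s < α)
    {Γ : Phase d → Phase d → EuclideanSpace ℝ (Fin d)} (hΓ : FiniteInteractionNorm s α Γ)
    (i : Fin d) :
    ∃ (B : HSob d s →L[ℂ] HDual d s →L[ℂ] HSob d s) (b : ℝ), 0 ≤ b ∧
      (∀ g μ, ‖B g μ‖ ≤ b * ‖g‖ * ‖μ‖) ∧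
      ∀ g μ, (fun z => g.toL2 z * genConv Γ μ i z) =ᵐ[volume] (B g μ).toL2 := by
  obtain ⟨C, hC, h⟩ := exists_sobEnergy_mul_le d hs hα
  obtain ⟨-, hF, hFK⟩ := hΓ i
  set F : Phase d → HSob d s := fun z => HSob.ofFun s fun w => (Γ z w i : ℂ)
  set K := kinHolderNorm α F
  have hφm : ∀ μ : HDual d s, AEStronglyMeasurable (genConv Γ μ i) volume := fun μ =>
    μ.continuous.comp_aestronglyMeasurable hF
  have hφt : ∀ μ : HDual d s, eLpNorm (genConv Γ μ i) ⊤ volume ≤ ‖μ‖ₑ * K := fun μ =>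
    (eLpNorm_top_clm_comp_le μ F).trans (by gcongr; exact eLpNorm_le_kinHolderNorm α F)
  have hφd : ∀ (μ : HDual d s) (h : Phase d), h ≠ 0 →
      eLpNorm ((diffOp h)^[⌊α⌋₊ + 1] (genConv Γ μ i)) ⊤ volume ≤
        ‖μ‖ₑ * K * ENNReal.ofReal (kinLength h ^ α) := fun μ h hh => by
    have h1 := diffOp_iterate_clm_comp μ F h (⌊α⌋₊ + 1)
    have h2 : (fun z => μ (F z)) = genConv Γ μ i := rfl
    -- Differences commute with the functional `μ`, so the Hölder bounds of `Γ * μ` are those of `z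
    -- ↦ Γ(z, ·)` multiplied by `‖μ‖`.
    rw [h2] at h1
    rw [h1, mul_assoc]
    refine (eLpNorm_top_clm_comp_le μ _).trans ?_
    gcongr
    exact eLpNorm_diffOp_le_kinHolderNorm α F hh
  have hmem2 : ∀ (g : HSob d s) (μ : HDual d s),
      MemLp (fun z => g.toL2 z * genConv Γ μ i z) 2 volume := fun g μ => by
    refine ⟨(Lp.aestronglyMeasurable _).mul (hφm μ), ?_⟩
    simp only [mul_comm (g.toL2 _)]
    refine (eLpNorm_mul_le_top_two _ (Lp.aestronglyMeasurable _)).trans_lt ?_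
    exact ENNReal.mul_lt_top ((hφt μ).trans_lt (ENNReal.mul_lt_top enorm_lt_top hFK))
      (Lp.memLp _).2
  have hen : ∀ (g : HSob d s) (μ : HDual d s),
      sobEnergy s ((hmem2 g μ).toLp _) ≤ C * (‖μ‖ₑ * K) ^ 2 * sobEnergy s g.toL2 := fun g μ => by
    refine h (genConv Γ μ i) g.toL2 _ _ (hφm μ) (hφt μ) (hφd μ) ?_
    filter_upwards [(hmem2 g μ).coeFn_toLp] with z hz
    rw [hz, mul_comm]
  have hmem : ∀ (g : HSob d s) (μ : HDual d s), (hmem2 g μ).toLp _ ∈ sobSubmodule d s :=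
    fun g μ => mem_sobSubmodule_iff.mpr ((hen g μ).trans_lt (ENNReal.mul_lt_top
      (ENNReal.mul_lt_top hC.lt_top (ENNReal.pow_lt_top (ENNReal.mul_lt_top enorm_lt_top hFK)))
      (mem_sobSubmodule_iff.mp g.2)))
  let b : HSob d s → HDual d s → HSob d s := fun g μ => HSob.mk _ (hmem g μ)
  have hb : ∀ g μ, (fun z => g.toL2 z * genConv Γ μ i z) =ᵐ[volume] (b g μ).toL2 := fun g μ =>
    (hmem2 g μ).coeFn_toLp.symm
  let L : HSob d s →ₗ[ℂ] HDual d s →ₗ[ℂ] HSob d s := LinearMap.mk₂ ℂ b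
    (fun g₁ g₂ μ => HSob.ext_ae (by
      filter_upwards [hb (g₁ + g₂) μ, hb g₁ μ, hb g₂ μ, HSob.toL2_add_ae g₁ g₂,
        HSob.toL2_add_ae (b g₁ μ) (b g₂ μ)] with z h1 h2 h3 h4 h5
      rw [← h1, h5, ← h2, ← h3, h4, add_mul]))
    (fun c g μ => HSob.ext_ae (by
      filter_upwards [hb (c • g) μ, hb g μ, HSob.toL2_smul_ae c g,
        HSob.toL2_smul_ae c (b g μ)] with z h1 h2 h3 h4
      rw [← h1, h4, ← h2, h3, mul_assoc]))
    (fun g μ₁ μ₂ => HSob.ext_ae (by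
      filter_upwards [hb g (μ₁ + μ₂), hb g μ₁, hb g μ₂,
        HSob.toL2_add_ae (b g μ₁) (b g μ₂)] with z h1 h2 h3 h4
      rw [← h1, h4, ← h2, ← h3, ← mul_add]
      rfl))
    (fun c g μ => HSob.ext_ae (by
      filter_upwards [hb g (c • μ), hb g μ, HSob.toL2_smul_ae c (b g μ)] with z h1 h2 h3
      rw [← h1, h3, ← h2, mul_left_comm]
      rfl))
  have hCK : C * K ^ 2 ≠ ⊤ := ENNReal.mul_ne_top hC (ENNReal.pow_ne_top hFK.ne)
  have hbound : ∀ g μ, ‖L g μ‖ ≤ Real.sqrt (C * K ^ 2).toReal * ‖g‖ * ‖μ‖ := fun g μ => by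
    have h1 : ‖b g μ‖ₑ ^ 2 ≤ C * K ^ 2 * (‖g‖ₑ ^ 2 * ‖μ‖ₑ ^ 2) := by
      rw [HSob.enorm_sq, HSob.enorm_sq]
      calc _ ≤ ENNReal.ofReal (((2 * Real.pi) ^ d) ^ 2) *
            (C * (‖μ‖ₑ * K) ^ 2 * sobEnergy s g.toL2) := by gcongr; exact hen g μ
        _ = _ := by ring
    have h2 : ‖b g μ‖ ^ 2 ≤ (C * K ^ 2).toReal * (‖g‖ ^ 2 * ‖μ‖ ^ 2) := by
      have := ENNReal.toReal_mono (by finiteness) h1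
      simpa only [ENNReal.toReal_mul (a := C * K ^ 2), ENNReal.toReal_mul (a := ‖g‖ₑ ^ 2),
        ENNReal.toReal_pow ‖g‖ₑ, ENNReal.toReal_pow ‖μ‖ₑ, ENNReal.toReal_pow ‖b g μ‖ₑ,
        toReal_enorm] using this
    refine le_of_sq_le_sq (h2.trans_eq ?_) (by positivity)
    rw [mul_pow, mul_pow, Real.sq_sqrt ENNReal.toReal_nonneg, mul_assoc]
  exact ⟨L.mkContinuous₂ _ hbound, _, Real.sqrt_nonneg _, hbound, fun g μ => hb g μ⟩

end Product

/-! ### The Abel kernel under exponential weights -/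

section SingularKernel

theorem integrableOn_rpow_neg_half_mul_exp {l : ℝ} (hl : 0 < l) :
    IntegrableOn (fun x : ℝ => x ^ (-(1 / 2) : ℝ) * Real.exp (-(l * x))) (Ioi 0) := by
  have := integrableOn_rpow_mul_exp_neg_mul_rpow (p := 1) (s := -(1 / 2)) (b := l)
    (by norm_num) one_pos hl
  simpa using this

/-- The Abel kernel `(t - r)^{-1/2}` is small against exponential weights. -/
theorem exists_abel_kernel_le (A : ℝ) : ∃ l : ℝ, 0 < l ∧ ∀ t : ℝ, 0 ≤ t →
    IntervalIntegrable (fun r : ℝ => (t - r) ^ (-(1 / 2) : ℝ) * Real.exp (l * r)) volume 0 t ∧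
    A * ∫ r in (0 : ℝ)..t, (t - r) ^ (-(1 / 2) : ℝ) * Real.exp (l * r) ≤
      1 / 2 * Real.exp (l * t) := by
  have hpi := Real.pi_pos
  -- After factoring out `exp (l t)` the integral is at most `√(π / l)`, by `Γ(1/2) = √π`; this `l`
  -- makes `A² π / l ≤ 1/4`.
  obtain ⟨l, hl⟩ : ∃ l : ℝ, l = 4 * Real.pi * (A ^ 2 + 1) := ⟨_, rfl⟩
  have hl0 : 0 < l := hl ▸ by positivity
  refine ⟨l, hl0, fun t ht => ?_⟩
  have hfun : ∀ r : ℝ, (t - r) ^ (-(1 / 2) : ℝ) * Real.exp (l * r) =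
      Real.exp (l * t) * ((t - r) ^ (-(1 / 2) : ℝ) * Real.exp (-(l * (t - r)))) := fun r => by
    rw [mul_left_comm, ← Real.exp_add]; congr 2; ring
  have hI := integrableOn_rpow_neg_half_mul_exp hl0
  have hint : IntervalIntegrable (fun x : ℝ => x ^ (-(1 / 2) : ℝ) * Real.exp (-(l * x)))
      volume 0 t :=
    (intervalIntegrable_iff_integrableOn_Ioc_of_le ht).mpr (hI.mono_set Ioc_subset_Ioi_self)
  refine ⟨?_, ?_⟩
  · simp only [hfun]
    have := (hint.comp_sub_left t).symm
    simp only [sub_zero, sub_self] at this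
    exact this.const_mul _
  · simp only [hfun]
    rw [intervalIntegral.integral_const_mul, intervalIntegral.integral_comp_sub_left
      (fun x => x ^ (-(1 / 2) : ℝ) * Real.exp (-(l * x))), sub_self, sub_zero]
    have hle : ∫ x in (0 : ℝ)..t, x ^ (-(1 / 2) : ℝ) * Real.exp (-(l * x)) ≤
        ∫ x in Ioi (0 : ℝ), x ^ (-(1 / 2) : ℝ) * Real.exp (-(l * x)) := by
      rw [intervalIntegral.integral_of_le ht]
      refine setIntegral_mono_set hI ?_ (Filter.Eventually.of_forall Ioc_subset_Ioi_self)
      refine (ae_restrict_iff' measurableSet_Ioi).mpr (Filter.Eventually.of_forall fun x hx => ?_)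
      have : (0 : ℝ) < x := hx
      simp only [Pi.zero_apply]
      positivity
    have h0 : 0 ≤ ∫ x in (0 : ℝ)..t, x ^ (-(1 / 2) : ℝ) * Real.exp (-(l * x)) :=
      intervalIntegral.integral_nonneg ht fun x hx => by
        have := hx.1; positivity
    have hval := Real.integral_rpow_mul_exp_neg_mul_Ioi (a := 1 / 2) (by norm_num) hl0
    norm_num [Real.Gamma_one_half_eq] at hval
    have hle' : ∫ x in (0 : ℝ)..t, x ^ (-(1 / 2) : ℝ) * Real.exp (-(l * x)) ≤
        Real.sqrt (Real.pi / l) := by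
      refine hle.trans_eq (hval.trans ?_)
      rw [← Real.sqrt_eq_rpow, ← Real.sqrt_mul (by positivity), inv_mul_eq_div]
    have hA : A * Real.sqrt (Real.pi / l) ≤ 1 / 2 := by
      refine le_of_sq_le_sq ?_ (by norm_num)
      rw [mul_pow, Real.sq_sqrt (by positivity), hl, mul_div_assoc', div_le_iff₀ (by positivity)]
      nlinarith [mul_nonneg hpi.le (sq_nonneg A)]
    rcases le_or_gt A 0 with hA0 | hA0
    · have h1 := Real.exp_pos (l * t)
      have h2 := mul_nonneg h1.le h0
      nlinarith
    · calc _ = Real.exp (l * t) * (A * ∫ x in (0 : ℝ)..t,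
            x ^ (-(1 / 2) : ℝ) * Real.exp (-(l * x))) := by ring
        _ ≤ Real.exp (l * t) * (1 / 2) := by
          gcongr
          exact (mul_le_mul_of_nonneg_left hle' hA0.le).trans hA
        _ = _ := by ring

end SingularKernel

/-! ### Stability of weak-mild solutions and uniqueness -/

section Uniqueness

variable {d : ℕ} {s : ℝ}

/-- The nonlinear term of the mild formulation, written with bounded operators on `H^s_k`. -/
theorem pairing_drift_eq (hs : 0 < s) {Γ : Phase d → Phase d → EuclideanSpace ℝ (Fin d)}
    {B : Fin d → HSob d s →L[ℂ] HDual d s →L[ℂ] HSob d s}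
    (hB : ∀ (i : Fin d) (g : HSob d s) (μ : HDual d s),
      (fun z => g.toL2 z * genConv Γ μ i z) =ᵐ[volume] (B i g μ).toL2)
    (μ : HDual d s) (f : HSob d s) {τ : ℝ} (hτ : 0 < τ) :
    (pairing μ fun z => ∑ i : Fin d, velDeriv i (kinSemigroup τ f.toL2) z * genConv Γ μ i z) =
      ∑ i : Fin d, μ (B i (velGrad i τ f) μ) := by
  rw [pairing, HSob.ofFun_sum Finset.univ
    (fun i z => velDeriv i (kinSemigroup τ f.toL2) z * genConv Γ μ i z)
    (fun i => B i (velGrad i τ f) μ) fun i _ => ?_, map_sum]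
  filter_upwards [hB i (velGrad i τ f) μ, HSob.ofFun_toL2_ae (memHSob_velDeriv hs i hτ f)]
    with z h1 h2
  rw [← h1, velGrad, h2]

theorem exists_ae_norm_le {T : ℝ} {ν : ℝ → HDual d s}
    (hν : MemLp ν ⊤ (volume.restrict (Icc 0 T))) :
    ∃ M : ℝ, 0 ≤ M ∧ ∀ᵐ r ∂volume.restrict (Icc 0 T), ‖ν r‖ ≤ M := by
  refine ⟨(eLpNorm ν ⊤ (volume.restrict (Icc 0 T))).toReal, ENNReal.toReal_nonneg, ?_⟩
  filter_upwards [enorm_ae_le_eLpNormEssSup ν (volume.restrict (Icc 0 T))] with r hr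
  rw [← eLpNorm_exponent_top] at hr
  rw [← toReal_enorm]
  exact ENNReal.toReal_mono hν.2.ne hr

/-- A non-integrable integrand would have integral `0` by convention, so the two mild identities
cannot be subtracted under the integral without this. The singularity `(t - r)^(-1/2)` dominates. -/
theorem intervalIntegrable_drift (hs : 0 < s)
    (B : Fin d → HSob d s →L[ℂ] HDual d s →L[ℂ] HSob d s) {b : Fin d → ℝ} (hb0 : ∀ i, 0 ≤ b i)
    (hb : ∀ i g μ, ‖B i g μ‖ ≤ b i * ‖g‖ * ‖μ‖) (f : HSob d s) {T t : ℝ}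
    (ht : t ∈ Icc 0 T) {ν : ℝ → HDual d s} (hν : MemLp ν ⊤ (volume.restrict (Icc 0 T))) :
    IntervalIntegrable (fun r => ∑ i : Fin d, ν r (B i (velGrad i (t - r) f) (ν r)))
      volume 0 t := by
  obtain ⟨C, hC, hD⟩ := exists_norm_velGrad_le d hs
  obtain ⟨M, hM, hνM⟩ := exists_ae_norm_le hν
  rw [intervalIntegrable_iff_integrableOn_Ioo_of_le ht.1]
  have hsub : Ioo 0 t ⊆ Icc 0 T := fun r hr => ⟨hr.1.le, hr.2.le.trans ht.2⟩
  have hνm : AEStronglyMeasurable ν (volume.restrict (Ioo 0 t)) :=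
    hν.1.mono_measure (Measure.restrict_mono hsub le_rfl)
  have hνb : ∀ᵐ r ∂volume.restrict (Ioo 0 t), ‖ν r‖ ≤ M :=
    ae_restrict_of_ae_restrict_of_subset hsub hνM
  have hk : IntegrableOn (fun r : ℝ => (t - r) ^ (-(1 / 2) : ℝ)) (Ioo 0 t) := by
    have h1 : IntervalIntegrable (fun x : ℝ => x ^ (-(1 / 2) : ℝ)) volume 0 t :=
      intervalIntegral.intervalIntegrable_rpow' (by norm_num)
    have h2 := (h1.comp_sub_left t).symm
    simp only [sub_zero, sub_self] at h2
    exact (intervalIntegrable_iff_integrableOn_Ioo_of_le ht.1).mp h2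
  refine integrable_finsetSum _ fun i _ => ?_
  have hDm : AEStronglyMeasurable (fun r => velGrad i (t - r) f) (volume.restrict (Ioo 0 t)) := by
    refine ContinuousOn.aestronglyMeasurable ?_ measurableSet_Ioo
    exact (continuousOn_velGrad hs i f).comp (continuous_const.sub continuous_id).continuousOn
      fun r hr => sub_pos.mpr hr.2
  have hBm : AEStronglyMeasurable (fun r => B i (velGrad i (t - r) f) (ν r))
      (volume.restrict (Ioo 0 t)) := (B i).aestronglyMeasurable_comp₂ hDm hνm
  have hm : AEStronglyMeasurable (fun r => ν r (B i (velGrad i (t - r) f) (ν r)))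
      (volume.restrict (Ioo 0 t)) :=
    (ContinuousLinearMap.id ℂ (HDual d s)).aestronglyMeasurable_comp₂ hνm hBm
  refine (hk.const_mul (M * (b i * (C * ‖f‖) * M))).mono' hm ?_
  filter_upwards [hνb, ae_restrict_mem measurableSet_Ioo] with r h1 h2
  have hbi := hb0 i
  have h3 := hD i (t - r) (sub_pos.mpr h2.2) f
  have h4 : 0 ≤ (t - r) ^ (-(1 / 2) : ℝ) := Real.rpow_nonneg (sub_nonneg.mpr h2.2.le) _
  calc _ ≤ ‖ν r‖ * (b i * ‖velGrad i (t - r) f‖ * ‖ν r‖) :=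
        ((ν r).le_opNorm _).trans (by gcongr; exact hb i _ _)
    _ ≤ M * (b i * (C * (t - r) ^ (-(1 / 2) : ℝ) * ‖f‖) * M) := by gcongr
    _ = _ := by ring

/-- The stability estimate for two weak-mild solutions with the same initial datum. -/
theorem exists_contraction {α T : ℝ} (hs : 0 < s) (hα : s < α)
    {Γ : Phase d → Phase d → EuclideanSpace ℝ (Fin d)} (hΓ : FiniteInteractionNorm s α Γ)
    {ν₀ : HDual d s} {ν ρ : ℝ → HDual d s} (hν : IsWeakMildSolution T Γ ν₀ ν)
    (hρ : IsWeakMildSolution T Γ ν₀ ρ) :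
    ∃ l : ℝ, 0 < l ∧ ∀ S : ℝ, 0 ≤ S →
      (∀ᵐ r ∂volume.restrict (Icc 0 T), ‖ν r - ρ r‖ ≤ S * Real.exp (l * r)) →
      ∀ t ∈ Icc 0 T, ‖ν t - ρ t‖ ≤ S / 2 * Real.exp (l * t) := by
  choose B b hb0 hb hB using fun i => exists_mulGenConv hs hα hΓ i
  obtain ⟨C, hC, hD⟩ := exists_norm_velGrad_le d hs
  obtain ⟨M, hM, hνM⟩ := exists_ae_norm_le hν.memLp
  obtain ⟨N, hN, hρN⟩ := exists_ae_norm_le hρ.memLp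
  obtain ⟨A, hA⟩ : ∃ A : ℝ, A = ∑ i : Fin d, b i * C * (M + N) := ⟨_, rfl⟩
  obtain ⟨l, hl, hker⟩ := exists_abel_kernel_le A
  refine ⟨l, hl, fun S hS hle t ht => ?_⟩
  obtain ⟨hkint, hkle⟩ := hker t ht.1
  refine ContinuousLinearMap.opNorm_le_bound _ (by positivity) fun f => ?_
  have hdrift : ∀ {σ : ℝ → HDual d s}, IsWeakMildSolution T Γ ν₀ σ →
      σ t f = pairing ν₀ (kinSemigroup t f.toL2) +
        ∫ r in (0 : ℝ)..t, ∑ i : Fin d, σ r (B i (velGrad i (t - r) f) (σ r)) := fun {σ} hσ => by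
    rw [hσ.mild f t ht]
    congr 1
    refine intervalIntegral.integral_congr_ae ?_
    -- At `r = t` the semigroup is the identity and no smoothing is available; this single time is
    -- negligible.
    have hne : ∀ᵐ r : ℝ, r ≠ t := Measure.ae_ne volume t
    filter_upwards [hne] with r hr hr'
    rw [uIoc_of_le ht.1] at hr'
    exact pairing_drift_eq hs hB (σ r) f (sub_pos.mpr (lt_of_le_of_ne hr'.2 hr))
  rw [sub_apply, hdrift hν, hdrift hρ, add_sub_add_left_eq_sub,
    ← intervalIntegral.integral_sub (intervalIntegrable_drift hs B hb0 hb f ht hν.memLp)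
      (intervalIntegrable_drift hs B hb0 hb f ht hρ.memLp)]
  have hbound : ∀ᵐ r : ℝ, r ∈ Ioc 0 t →
      ‖∑ i : Fin d, ν r (B i (velGrad i (t - r) f) (ν r)) -
        ∑ i : Fin d, ρ r (B i (velGrad i (t - r) f) (ρ r))‖ ≤
      A * S * ‖f‖ * ((t - r) ^ (-(1 / 2) : ℝ) * Real.exp (l * r)) := by
    have hne : ∀ᵐ r : ℝ, r ≠ t := Measure.ae_ne volume t
    filter_upwards [hne, (ae_restrict_iff' measurableSet_Icc).mp hνM,
      (ae_restrict_iff' measurableSet_Icc).mp hρN,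
      (ae_restrict_iff' measurableSet_Icc).mp hle] with r hr h1 h2 h3 hr'
    have hrT : r ∈ Icc 0 T := ⟨hr'.1.le, hr'.2.trans ht.2⟩
    have hpos : 0 < t - r := sub_pos.mpr (lt_of_le_of_ne hr'.2 hr)
    replace h1 := h1 hrT
    replace h2 := h2 hrT
    replace h3 := h3 hrT
    set k := (t - r) ^ (-(1 / 2) : ℝ) with hk
    have hk0 : 0 ≤ k := by positivity
    rw [← Finset.sum_sub_distrib, hA, Finset.sum_mul, Finset.sum_mul, Finset.sum_mul]
    refine norm_sum_le_of_le _ fun i _ => ?_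
    have hbi := hb0 i
    have h4 := hD i (t - r) hpos f
    set D := velGrad i (t - r) f
    -- The drift is quadratic in the solution; adding and subtracting a mixed term makes each piece
    -- linear in `ν r - ρ r`, with the other factor bounded by `M` or `N`.
    have hsplit : ν r (B i D (ν r)) - ρ r (B i D (ρ r)) =
        (ν r - ρ r) (B i D (ν r)) + ρ r (B i D (ν r - ρ r)) := by
      simp only [sub_apply, map_sub]; ring
    rw [hsplit]
    calc _ ≤ ‖ν r - ρ r‖ * (b i * ‖D‖ * ‖ν r‖) + ‖ρ r‖ * (b i * ‖D‖ * ‖ν r - ρ r‖) := by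
          refine (norm_add_le _ _).trans (add_le_add ?_ ?_)
          · exact (ContinuousLinearMap.le_opNorm _ _).trans
              (by gcongr; exact hb i _ _)
          · exact (ContinuousLinearMap.le_opNorm _ _).trans
              (by gcongr; exact hb i _ _)
      _ ≤ (S * Real.exp (l * r)) * (b i * (C * k * ‖f‖) * M) +
          N * (b i * (C * k * ‖f‖) * (S * Real.exp (l * r))) := by gcongr
      _ = _ := by ring
  refine (intervalIntegral.norm_integral_le_of_norm_le ht.1 hbound (hkint.const_mul _)).trans ?_
  rw [intervalIntegral.integral_const_mul]
  calc _ = S * ‖f‖ * (A * ∫ r in (0 : ℝ)..t, (t - r) ^ (-(1 / 2) : ℝ) * Real.exp (l * r)) := by ring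
    _ ≤ S * ‖f‖ * (1 / 2 * Real.exp (l * t)) := by gcongr
    _ = _ := by ring

end Uniqueness

end KineticFP

end

theorem proposition3p5 (d : ℕ) (hd : 1 ≤ d) (T : ℝ) (hT : 0 < T) (s α : ℝ) (hs : 0 < s)
    (hα : s < α) (hα_nonint : ∀ n : ℕ, α ≠ n)
    (Γ : KineticFP.Phase d → KineticFP.Phase d → EuclideanSpace ℝ (Fin d))
    (hΓ : KineticFP.FiniteInteractionNorm s α Γ)
    (ν₀ : KineticFP.HDual d s) (ν ρ : ℝ → KineticFP.HDual d s)
    (hν : KineticFP.IsWeakMildSolution T Γ ν₀ ν)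
    (hρ : KineticFP.IsWeakMildSolution T Γ ν₀ ρ) :
    ∀ t ∈ Set.Icc (0 : ℝ) T, ν t = ρ t := by
  obtain ⟨l, hl, hstep⟩ := KineticFP.exists_contraction hs hα hΓ hν hρ
  obtain ⟨M, hM, hνM⟩ := KineticFP.exists_ae_norm_le hν.memLp
  obtain ⟨N, hN, hρN⟩ := KineticFP.exists_ae_norm_le hρ.memLp
  -- The first application turns the almost everywhere bound `M + N` into a bound at every time,
  -- since the mild identity holds at every `t`; each further application halves the constant.
  have hiter : ∀ n : ℕ, ∀ t ∈ Set.Icc (0 : ℝ) T,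
      ‖ν t - ρ t‖ ≤ (M + N) / 2 ^ (n + 1) * Real.exp (l * t) := by
    intro n
    induction n with
    | zero =>
      rw [zero_add, pow_one]
      refine hstep (M + N) (by positivity) ?_
      filter_upwards [hνM, hρN, MeasureTheory.ae_restrict_mem measurableSet_Icc] with r h1 h2 h3
      have h4 : 1 ≤ Real.exp (l * r) := Real.one_le_exp (mul_nonneg hl.le h3.1)
      calc ‖ν r - ρ r‖ ≤ M + N := (norm_sub_le _ _).trans (add_le_add h1 h2)
        _ ≤ _ := le_mul_of_one_le_right (by positivity) h4
    | succ n ih =>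
      intro t ht
      have h1 := hstep ((M + N) / 2 ^ (n + 1)) (by positivity)
        ((MeasureTheory.ae_restrict_iff' measurableSet_Icc).mpr
          (Filter.Eventually.of_forall ih)) t ht
      rwa [div_div, ← pow_succ] at h1
  intro t ht
  have hlim : Filter.Tendsto (fun n : ℕ => (M + N) / 2 ^ (n + 1) * Real.exp (l * t))
      Filter.atTop (nhds 0) := by
    have h1 : Filter.Tendsto (fun n : ℕ => (1 / 2 : ℝ) ^ (n + 1)) Filter.atTop (nhds 0) :=
      (tendsto_pow_atTop_nhds_zero_of_lt_one (by norm_num) (by norm_num)).comp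
        (Filter.tendsto_add_atTop_nat 1)
    have h2 := (h1.const_mul (M + N)).mul_const (Real.exp (l * t))
    simp only [mul_zero, zero_mul] at h2
    refine h2.congr fun n => ?_
    rw [one_div, inv_pow, div_eq_mul_inv]
  have h0 : ‖ν t - ρ t‖ ≤ 0 := ge_of_tendsto' hlim fun n => hiter n t ht
  exact sub_eq_zero.mp (norm_le_zero_iff.mp h0)
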